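/- For $0<q<1$ put $$(a;q)_n=\prod_{k=1}^{n}(1-aq^{k-1})\quad(n\ge 0),\qquad (a;q)_{-m}=\prod_{k=1}^{m}\frac1{1-aq^{-k}}\quad(m\ge1),\qquad (a;q)_\infty=\prod_{k=1}^{\infty}(1-aq^{k-1}),$$ $$[k]_q=\frac{1-q^k}{1-q}\ (k\in\mathbb Z),\qquad [r]_q!=\prod_{i=1}^r[i]_q,\qquad \begin{bmatrix}n\\ m\end{bmatrix}_q=\frac{(q^{n-m+1};q)_m}{(q;q)_m}\ (0\le m\le n),\qquad \Gamma_q(x)=(1-q)^{1-x}\frac{(q;q)_\infty}{(q^x;q)_\infty}.$$ For a positive integer $r$ and a non-negative integer $n$, and with $\Delta(x)=\prod_{1\le i<j\le r}(x_i-x_j)$ and $k^\alpha=(k_1^\alpha,\dots,k_r^\alpha)$, let $$\mathcal S_{r,n}(\alpha,\gamma,\delta)=\sum_{k_1,\dots,k_r=-n}^{n}|\Delta(k^\alpha)|^{2\gamma}\prod_{i=1}^r|k_i|^\delta\binom{2n}{n+k_i}.$$ Proposition. Let $r$ be a positive integer and $n$ an integer such that $n\ge r$. Then for every real $q$ with $0<q<1$,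 $$\sum_{k_1,\dots,k_r=-n}^n\ \prod_{1\le i<j\le r}\bigl|[k_i-k_j]_q\,[k_i+k_j]_q\bigr|\ \prod_{i=1}^r[k_i]_q^2\,q^{(k_i-r+i-1)^2/2}\begin{bmatrix}2n\\ n+k_i\end{bmatrix}_q$$ $$=2^r\,\frac{r!}{[r]_q!}\cdot\frac{(-1;q^{1/2})_{r+1}\,(-q^{r/2+1};q)_{n-r}}{(-1;q)_{n-r}}\ \prod_{i=1}^{r+1}\frac{(-q^{1/2};q^{1/2})_{i-1}\,(-q^{1/2};q^{1/2})_{2n-i-r}}{(-q^{1/2};q^{1/2})_{2n-2i+2}}$$ $$\times\ \prod_{i=1}^r\frac{\Gamma_q(1+\tfrac12 i)^2}{\Gamma_q(\tfrac12)}\cdot\frac{\Gamma_q(2n+1)\,\Gamma_q(n-i+\tfrac32)}{\Gamma_q(n-i+1)\,\Gamma_q(n-\tfrac12 i+1)^2}.$$ Moreover, at $q=1$, for the same $r$ and $n$, $$\mathcal S_{r,n}(2,\tfrac12,2)=\sum_{k_1,\dots,k_r=-n}^n\ \prod_{1\le i<j\le r}|k_i^2-k_j^2|\ \prod_{i=1}^r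 k_i^2\binom{2n}{n+k_i}=2^r\prod_{i=1}^r\frac{\Gamma(1+\tfrac12 i)^2}{\Gamma(\tfrac12)}\cdot\frac{\Gamma(2n+1)\,\Gamma(n-i+\tfrac32)}{\Gamma(n-i+1)\,\Gamma(n-\tfrac12 i+1)^2}.$$ -/

import Mathlib

noncomputable section

namespace DiscreteMM

open Finset

/-- The infinite `q`-shifted factorial `(a;q)_∞ = ∏_{k ≥ 0} (1 - a q^k)`; the product converges
for `0 < q < 1`. -/
def qPochInf (a q : ℝ) : ℝ := ∏' k : ℕ, (1 - a * q ^ k)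

/-- The `q`-shifted factorial `(a;q)_n` for integer `n`:
`(a;q)_n = ∏_{k=1}^{n} (1 - a q^{k-1})` for `n ≥ 0`, and, as usual,
`(a;q)_{-m} = ∏_{k=1}^{m} 1 / (1 - a q^{-k})` for `m ≥ 1`
(so that `(a;q)_n = (a;q)_∞ / (a q^n;q)_∞` in all cases where the right side makes sense). -/
def qPoch (a q : ℝ) : ℤ → ℝ
  | Int.ofNat n => ∏ k ∈ range n, (1 - a * q ^ k)
  | Int.negSucc m => ∏ k ∈ range (m + 1), (1 - a * q ^ (-((k : ℤ) + 1)))⁻¹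

/-- The `q`-number `[k]_q = (1 - q^k) / (1 - q)` of an integer `k`. -/
def qNum (q : ℝ) (k : ℤ) : ℝ := (1 - q ^ k) / (1 - q)

/-- The `q`-factorial `[n]_q! = [n]_q [n-1]_q ⋯ [1]_q`. -/
def qFactorial (q : ℝ) (n : ℕ) : ℝ := ∏ i ∈ Icc 1 n, qNum q i

/-- The `q`-binomial coefficient `(q^{n-m+1};q)_m / (q;q)_m`, for `0 ≤ m ≤ n`. -/
def qBinom (q : ℝ) (n m : ℤ) : ℝ := qPoch (q ^ (n - m + 1)) q m / qPoch q q m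

/-- The `q`-gamma function `Γ_q(x) = (1-q)^{1-x} (q;q)_∞ / (q^x;q)_∞`. -/
def qGamma (q x : ℝ) : ℝ := (1 - q) ^ (1 - x) * (qPochInf q q / qPochInf (q ^ x) q)

/-- The set of all `k = (k_1, …, k_r)` with integers `-n ≤ k_i ≤ n`. -/
def box (r n : ℕ) : Finset (Fin r → ℤ) := Fintype.piFinset fun _ => Icc (-(n : ℤ)) (n : ℤ)

/-- The Vandermonde product `Δ(x) = ∏_{i < j} (x_i - x_j)`. -/
def vandermonde {r : ℕ} (x : Fin r → ℝ) : ℝ := ∏ i : Fin r, ∏ j ∈ Ioi i, (x i - x j)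

/-- The discrete Macdonald–Mehta integral
`S_{r,n}(α,γ,δ) = ∑_{k_1,…,k_r=-n}^{n} |Δ(k^α)|^{2γ} ∏_i |k_i|^δ binom(2n, n+k_i)`. -/
def discreteMacdonaldMehta (r n α : ℕ) (γ : ℝ) (δ : ℕ) : ℝ :=
  ∑ k ∈ box r n,
    |vandermonde fun i => (k i : ℝ) ^ α| ^ (2 * γ) *
      ∏ i : Fin r, |(k i : ℝ)| ^ δ * ((2 * n).choose ((n : ℤ) + k i).toNat : ℝ)

end DiscreteMM

end

noncomputable section

namespace DiscreteMM

open Finset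

/-! Put `q = P⁻⁴` and `x_a = q^a + q^{-a}`. Since `(1 - q^{a-b})(1 - q^{a+b}) = q^a (x_a - x_b)`,
completing the square in the exponent of `q` turns the summand into a constant times a function of
the `|k_i|`: the Vandermonde product of the `x_{k_i}` times a product of one-variable weights. Terms
with some `k_i = 0` or with two equal `|k_i|` vanish, so the sum is `2^r r!` times a sum over
`r`-subsets `A` of `{1, …, n}`.

The weight of `a` is, up to a constant, the reciprocal of `(q^{a/2} + q^{-a/2}) ∏_{m ≠ a} |x_a -
x_m|`. Therefore the summand of `A` is proportional to the Vandermonde product of the complement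
`B`, times `∏_{b ∈ B} (q^{b/2} + q^{-b/2})` (`gapProd_compl`, `qWeight_eq`). This leaves a sum over
subsets of size `m = n - r`.

Each dual summand is, up to a factor independent of `B`, a determinant `det (Y_i^{2b_j} +
Y_i^{-2b_j})` at `Y_i = P^{2i+1}`. For general `Y` the sum of these determinants over `1 ≤ b_1 < ⋯ <
b_m ≤ n` factors as a product of two alternants with exponents in arithmetic progression
(`chainSum_mul_eq`), a bounded Littlewood-type identity for sums of classical characters. It is
proved by induction on `n`: expanding the last column on one side must match a recurrence for
products of alternants (`alt_recurrence`), which, sign pattern by sign pattern, is a partial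
fraction identity. At `Y_i = P^{2i+1}` both alternants are Vandermonde products again.

The resulting product is compared with the Gamma product by induction on `r` with `m` fixed
(`qSumValue_eq`): both sides equal `1` at `r = 0` and have the same ratio from `r` to `r + 1`. The
case `q = 1` is the limit `q → 1⁻`. There the Gamma quotients reduce to finite products of
`q`-numbers, so convergence of `Γ_q` to `Γ` is not needed. -/

/-! ### Partial fractions -/

/-- The polynomial `∏ (1 - X k)` has degree at most `#T`, so its Lagrange interpolation at the `#T +
2` nodes `T ∪ {0, -1}` has vanishing top coefficient. The nodes `0` and `-1` produce the right-hand
side. At a node `t` the factor `1 - t²` of the value cancels against `t - (-1)`, leaving `1 - t`. -/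
theorem sum_partialFraction_real (T : Finset ℝ) (hT : ∀ t ∈ T, 0 < t) :
    ∑ t ∈ T, (1 - t) * ∏ s ∈ T.erase t, ((1 - t * s) * s / (s - t)) = 1 - ∏ t ∈ T, t := by
  classical
  have h1 : (-1 : ℝ) ∉ T := fun h => by linarith [hT _ h]
  have h0' : (0 : ℝ) ∉ T := fun h => by linarith [hT _ h]
  have h0 : (0 : ℝ) ∉ insert (-1 : ℝ) T := by simp [h0']
  set s : Finset ℝ := insert 0 (insert (-1) T) with hs
  let f : Polynomial ℝ := ∏ k ∈ T, (1 - Polynomial.X * Polynomial.C k)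
  have hcard : #s = #T + 2 := by rw [hs, card_insert_of_notMem h0, card_insert_of_notMem h1]
  have hdeg : f.degree ≤ #T := by
    refine (Polynomial.degree_prod_le _ _).trans ?_
    refine (Finset.sum_le_card_nsmul T _ (1 : WithBot ℕ) fun k _ => ?_).trans (by simp)
    refine (Polynomial.degree_sub_le _ _).trans (max_le (by simp) ?_)
    refine (Polynomial.degree_mul_le _ _).trans ?_
    rw [Polynomial.degree_X]
    exact (add_le_add_right Polynomial.degree_C_le 1).trans (by simp)
  have hlt : f.degree < (#T + 1 : ℕ) := lt_of_le_of_lt hdeg (by exact_mod_cast Nat.lt_succ_self _)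
  have key := Lagrange.coeff_eq_sum (s := s) (v := id) (Set.injOn_id _) (P := f)
    (lt_of_lt_of_le hlt (by rw [hcard]; exact_mod_cast Nat.le_succ _))
  rw [hcard, show #T + 2 - 1 = #T + 1 from rfl,
    Polynomial.coeff_eq_zero_of_degree_lt hlt, hs, sum_insert h0, sum_insert h1] at key
  have ev : ∀ z : ℝ, f.eval z = ∏ k ∈ T, (1 - z * k) := fun z => by
    simp only [f, Polynomial.eval_prod, Polynomial.eval_sub, Polynomial.eval_one,
      Polynomial.eval_mul, Polynomial.eval_X, Polynomial.eval_C]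
  have hP : ∏ t ∈ T, t ≠ 0 := prod_ne_zero_iff.2 fun t ht => (hT t ht).ne'
  have e0 : f.eval (id 0) / ∏ j ∈ (insert 0 (insert (-1) T)).erase (0 : ℝ), (id (0 : ℝ) - id j)
      = (∏ t ∈ T, (-t))⁻¹ := by
    rw [erase_insert h0, prod_insert h1, ev]; simp
  have e1 : f.eval (id (-1)) / ∏ j ∈ (insert 0 (insert (-1) T)).erase (-1 : ℝ),
      (id (-1 : ℝ) - id j) = - (∏ t ∈ T, (-1 : ℝ))⁻¹ := by
    have : (insert 0 (insert (-1) T)).erase (-1 : ℝ) = insert 0 T := by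
      rw [Finset.insert_comm, erase_insert]; simp [h1]
    rw [this, prod_insert h0', ev]
    have : ∏ t ∈ T, (1 + t) ≠ 0 := prod_ne_zero_iff.2 fun t ht => by linarith [hT t ht]
    have h2 : ∏ t ∈ T, (-1 - t) = (∏ t ∈ T, (-1 : ℝ)) * ∏ t ∈ T, (1 + t) := by
      rw [← prod_mul_distrib]; exact prod_congr rfl fun _ _ => by ring
    have h3 : (∏ t ∈ T, (-1 : ℝ)) ≠ 0 := prod_ne_zero_iff.2 fun _ _ => by norm_num
    simp only [id]
    rw [h2, prod_congr rfl (fun (t : ℝ) _ => show 1 - -1 * t = 1 + t by ring)]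
    field_simp
    ring
  have e2 : ∀ t ∈ T, f.eval (id t) / ∏ j ∈ (insert 0 (insert (-1) T)).erase t, (id t - id j)
      = (1 - t) * (∏ s ∈ T.erase t, ((1 - t * s) * s / (s - t))) * (∏ t ∈ T, (-1 : ℝ))⁻¹ *
        (-(∏ t ∈ T, t)⁻¹) := by
    intro t ht
    have hne : ∀ s ∈ T.erase t, t - s ≠ 0 := fun s hs => sub_ne_zero.2 (mem_erase.1 hs).1.symm
    have htp := (hT t ht).ne'
    rw [erase_insert_of_ne (ne_of_mem_of_not_mem ht h0').symm,
      erase_insert_of_ne (ne_of_mem_of_not_mem ht h1).symm,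
      prod_insert (by simp [h0']), prod_insert (by simp [h1]), ev]
    simp only [id]
    rw [← mul_prod_erase T (fun k => 1 - t * k) ht, ← mul_prod_erase T (fun k => (-1 : ℝ)) ht,
      ← mul_prod_erase T (fun k => k) ht]
    have h4 : ∏ s ∈ T.erase t, ((1 - t * s) * s / (s - t)) =
        (∏ s ∈ T.erase t, (1 - t * s)) * (∏ s ∈ T.erase t, s) * (∏ s ∈ T.erase t, (-1 : ℝ)) /
          ∏ s ∈ T.erase t, (t - s) := by
      rw [← prod_mul_distrib, ← prod_mul_distrib, ← prod_div_distrib]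
      refine prod_congr rfl fun s hs => ?_
      have := hne s hs
      rw [show s - t = -(t - s) by ring]
      field_simp
    have h5 : ∏ s ∈ T.erase t, (t - s) ≠ 0 := prod_ne_zero_iff.2 hne
    have h6 : ∏ s ∈ T.erase t, (-1 : ℝ) ≠ 0 := prod_ne_zero_iff.2 fun _ _ => by norm_num
    have h7 : ∏ s ∈ T.erase t, s ≠ 0 :=
      prod_ne_zero_iff.2 fun s hs => (hT s (mem_of_mem_erase hs)).ne'
    have h8 : t - -1 ≠ 0 := by linarith [hT t ht]
    rw [h4]
    field_simp
    ring
  rw [e0, e1, sum_congr rfl e2, ← sum_mul, ← sum_mul] at key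
  have h3 : (∏ t ∈ T, (-1 : ℝ)) ≠ 0 := prod_ne_zero_iff.2 fun _ _ => by norm_num
  have h9 : ∏ t ∈ T, (-t) = (∏ t ∈ T, (-1 : ℝ)) * ∏ t ∈ T, t := by
    rw [← prod_mul_distrib]; exact prod_congr rfl fun _ _ => by ring
  rw [h9] at key
  generalize ∑ t ∈ T, (1 - t) * ∏ s ∈ T.erase t, ((1 - t * s) * s / (s - t)) = S at key ⊢
  field_simp at key
  linarith

theorem sum_partialFraction {ι : Type*} [DecidableEq ι] (T : Finset ι) (w : ι → ℝ)
    (hw : ∀ i ∈ T, 0 < w i) (hinj : Set.InjOn w T) :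
    ∑ i ∈ T, (1 - (w i)⁻¹) * ∏ k ∈ T.erase i, ((w i - (w k)⁻¹) / (w i - w k))
      = 1 - ∏ i ∈ T, (w i)⁻¹ := by
  have hinj' : Set.InjOn (fun i => (w i)⁻¹) T := fun a ha b hb h => hinj ha hb (inv_injective h)
  have := sum_partialFraction_real (T.image fun i => (w i)⁻¹) (by
    intro t ht
    obtain ⟨i, hi, rfl⟩ := mem_image.1 ht
    exact inv_pos.2 (hw i hi))
  rw [sum_image hinj', prod_image hinj'] at this
  rw [← this]
  refine sum_congr rfl fun i hi => ?_
  congr 1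
  have he : (T.image fun i => (w i)⁻¹).erase (w i)⁻¹ = (T.erase i).image fun i => (w i)⁻¹ := by
    ext x
    simp only [mem_erase, mem_image]
    constructor
    · rintro ⟨hx, j, hj, rfl⟩
      exact ⟨j, ⟨fun h => hx (by rw [h]), hj⟩, rfl⟩
    · rintro ⟨j, ⟨hji, hj⟩, rfl⟩
      exact ⟨fun h => hji (hinj' hj hi h), j, hj, rfl⟩
  rw [he, prod_image (hinj'.mono (by simp))]
  refine prod_congr rfl fun k hk => ?_
  have h1 := (hw i hi).ne'
  have h2 := (hw k (mem_of_mem_erase hk)).ne'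
  have h3 : w i - w k ≠ 0 :=
    sub_ne_zero.2 fun h => (mem_erase.1 hk).1 (hinj (mem_of_mem_erase hk) hi h.symm)
  have h4 : (w k)⁻¹ - (w i)⁻¹ ≠ 0 := by
    rw [inv_sub_inv h2 h1]; exact div_ne_zero h3 (mul_ne_zero h2 h1)
  rw [div_eq_div_iff h3 h4]
  field_simp

/-! ### Alternants expanded over signs, and their recurrence -/

/-- The Vandermonde product `∏_{i < j} (v_j - v_i)`. -/
def vdm {m : ℕ} (v : Fin m → ℝ) : ℝ := ∏ i : Fin m, ∏ j ∈ Ioi i, (v j - v i)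

/-- Moving the `i`-th variable to the front is a cycle of sign `(-1)^i`; the remaining `(-1)^m`
reverses the `m` differences that contain it. -/
theorem vdm_succAbove {m : ℕ} (v : Fin (m + 1) → ℝ) (i : Fin (m + 1)) :
    vdm v = (-1) ^ ((i : ℕ) + m) * (∏ k, (v i - v (i.succAbove k))) * vdm (v ∘ i.succAbove) := by
  have h := Matrix.det_permute (i.cycleRange.symm) (Matrix.vandermonde v)
  rw [Equiv.Perm.sign_symm, Fin.sign_cycleRange] at h
  have h2 : (Matrix.vandermonde v).submatrix i.cycleRange.symm id =
      Matrix.vandermonde (Fin.cons (v i) (v ∘ i.succAbove)) := by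
    ext a b
    refine Fin.cases ?_ (fun a => ?_) a
    · simp [Matrix.vandermonde_apply, Fin.cycleRange_symm_zero]
    · simp [Matrix.vandermonde_apply, Fin.cycleRange_symm_succ]
  rw [h2, Matrix.det_vandermonde, Matrix.det_vandermonde, Fin.prod_univ_succ] at h
  simp only [Fin.prod_Ioi_zero, Fin.prod_Ioi_succ, Fin.cons_zero, Fin.cons_succ] at h
  have h3 : ∏ k, (v i - v (i.succAbove k)) = (-1) ^ m * ∏ k, (v (i.succAbove k) - v i) := by
    rw [← Fin.prod_const m (-1 : ℝ), ← prod_mul_distrib]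
    exact prod_congr rfl fun _ _ => by ring
  have h4 : ((-1 : ℝ) ^ (i : ℕ)) * (-1) ^ (i : ℕ) = 1 := by rw [← mul_pow]; simp
  have h5 : ((-1 : ℝ) ^ m) * (-1) ^ m = 1 := by rw [← mul_pow]; simp
  simp only [Function.comp] at h
  push_cast at h
  unfold vdm
  simp only [Function.comp]
  rw [h3, pow_add]
  calc _ = ((-1 : ℝ) ^ (i : ℕ)) * ((-1) ^ (i : ℕ) * ∏ i, ∏ j ∈ Ioi i, (v j - v i)) := by
        rw [← mul_assoc, h4, one_mul]
    _ = _ := by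
      rw [← h]
      linear_combination (-(-1 : ℝ) ^ (i : ℕ) * (∏ k, (v (i.succAbove k) - v i)) *
        ∏ x : Fin m, ∏ y ∈ Ioi x, (v (i.succAbove y) - v (i.succAbove x))) * h5

/-- The sign `±1` encoded by a Boolean. -/
def boolSign (b : Bool) : ℝ := if b then 1 else -1

/-- `Y` or `Y⁻¹`, according to a Boolean. -/
def boolPow (b : Bool) (Y : ℝ) : ℝ := if b then Y else Y⁻¹

/-- The summand of a hyperoctahedral alternant. -/
def altTerm {m : ℕ} (z : ℤ) (ε : Fin m → Bool) (Y : Fin m → ℝ) : ℝ :=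
  (∏ i, boolPow (ε i) (Y i) ^ z) * vdm fun i => boolPow (ε i) (Y i) ^ 2

/-- The alternant `det (Y_i^{z+2j} - Y_i^{-(z+2j)})`, expanded over signs. -/
def oddAlt {m : ℕ} (z : ℤ) (Y : Fin m → ℝ) : ℝ :=
  ∑ ε : Fin m → Bool, (∏ i, boolSign (ε i)) * altTerm z ε Y

/-- The alternant `det (Y_i^{z+2j} + Y_i^{-(z+2j)})`, expanded over signs. -/
def evenAlt {m : ℕ} (z : ℤ) (Y : Fin m → ℝ) : ℝ :=
  ∑ ε : Fin m → Bool, altTerm z ε Y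

/-- The summand of `oddAlt z Y * evenAlt (z + 1) Y`. -/
def pairTerm {m : ℕ} (z : ℤ) (σ : Fin m → Bool × Bool) (Y : Fin m → ℝ) : ℝ :=
  (∏ i, boolSign (σ i).1) * altTerm z (fun i => (σ i).1) Y * altTerm (z + 1) (fun i => (σ i).2) Y

theorem oddAlt_mul_evenAlt {m : ℕ} (z : ℤ) (Y : Fin m → ℝ) :
    oddAlt z Y * evenAlt (z + 1) Y = ∑ σ : Fin m → Bool × Bool, pairTerm z σ Y := by
  rw [oddAlt, evenAlt, sum_mul_sum, ← Fintype.sum_prod_type',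
    ← (Equiv.arrowProdEquivProdArrow (Fin m) (fun _ => Bool) (fun _ => Bool)).sum_comp]
  rfl

theorem altTerm_succAbove {m : ℕ} (z : ℤ) (ε : Fin (m + 1) → Bool) (Y : Fin (m + 1) → ℝ)
    (i : Fin (m + 1)) :
    altTerm z ε Y = boolPow (ε i) (Y i) ^ z * ((-1) ^ ((i : ℕ) + m) *
      ∏ k, (boolPow (ε i) (Y i) ^ 2 - boolPow (ε (i.succAbove k)) (Y (i.succAbove k)) ^ 2)) *
      altTerm z (ε ∘ i.succAbove) (Y ∘ i.succAbove) := by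
  rw [altTerm, vdm_succAbove _ i, Fin.prod_univ_succAbove _ i, altTerm]
  simp only [Function.comp_def]
  ring

theorem pairTerm_succAbove {m : ℕ} (z : ℤ) (σ : Fin (m + 1) → Bool × Bool) (Y : Fin (m + 1) → ℝ)
    (i : Fin (m + 1)) :
    pairTerm z σ Y = boolSign (σ i).1 * boolPow (σ i).1 (Y i) ^ z *
      boolPow (σ i).2 (Y i) ^ (z + 1) *
      (∏ k, ((boolPow (σ i).1 (Y i) ^ 2 -
        boolPow (σ (i.succAbove k)).1 (Y (i.succAbove k)) ^ 2) *
        (boolPow (σ i).2 (Y i) ^ 2 - boolPow (σ (i.succAbove k)).2 (Y (i.succAbove k)) ^ 2))) *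
      pairTerm z (σ ∘ i.succAbove) (Y ∘ i.succAbove) := by
  have h5 : ((-1 : ℝ) ^ ((i : ℕ) + m)) * (-1) ^ ((i : ℕ) + m) = 1 := by rw [← mul_pow]; simp
  rw [pairTerm, altTerm_succAbove _ _ _ i, altTerm_succAbove _ _ _ i,
    Fin.prod_univ_succAbove _ i, pairTerm, prod_mul_distrib]
  simp only [Function.comp_def]
  generalize (-1 : ℝ) ^ ((i : ℕ) + m) = e at *
  generalize altTerm z _ _ = a1
  generalize altTerm (z + 1) _ _ = a2
  linear_combination (boolSign (σ i).1 * (∏ x, boolSign (σ (i.succAbove x)).1) *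
    boolPow (σ i).1 (Y i) ^ z *
    (∏ x, (boolPow (σ i).1 (Y i) ^ 2 -
      boolPow (σ (i.succAbove x)).1 (Y (i.succAbove x)) ^ 2)) * a1 *
    boolPow (σ i).2 (Y i) ^ (z + 1) *
    (∏ x, (boolPow (σ i).2 (Y i) ^ 2 -
      boolPow (σ (i.succAbove x)).2 (Y (i.succAbove x)) ^ 2)) * a2) * h5

theorem boolPow_pos (b : Bool) {Y : ℝ} (hY : 1 < Y) : 0 < boolPow b Y := by
  unfold boolPow; split_ifs <;> positivity

theorem boolPow_sq_ne (a b : Bool) {Y Z : ℝ} (hY : 1 < Y) (hZ : 1 < Z) (h : Y ≠ Z) :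
    boolPow a Y ^ 2 ≠ boolPow b Z ^ 2 := by
  intro H
  have H' := (pow_left_inj₀ (boolPow_pos a hY).le (boolPow_pos b hZ).le two_ne_zero).1 H
  have h1 : Y⁻¹ < 1 := inv_lt_one_of_one_lt₀ hY
  have h2 : Z⁻¹ < 1 := inv_lt_one_of_one_lt₀ hZ
  cases a <;> cases b <;> simp [boolPow] at H'
  · exact h H'
  · linarith
  · linarith
  · exact h H'

/-- `Y² + Y⁻²`. -/
def sqSum (Y : ℝ) : ℝ := Y ^ 2 + (Y⁻¹) ^ 2

theorem sqSum_boolPow (b : Bool) (Y : ℝ) :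
    sqSum Y = boolPow b Y ^ 2 + (boolPow b Y ^ 2)⁻¹ := by
  cases b <;> simp [sqSum, boolPow, add_comm]

/-- Lowering `z` divides each of the two factors by its signed variables. Where the two signs differ
these are `Y` and `Y⁻¹` and cancel, so only the positions with equal signs contribute. -/
theorem pairTerm_pred {m : ℕ} (z : ℤ) (σ : Fin m → Bool × Bool) (Y : Fin m → ℝ)
    (hY : ∀ i, 1 < Y i) :
    pairTerm (z - 1) σ Y = pairTerm z σ Y *
      ∏ i ∈ univ.filter (fun i => (σ i).1 = (σ i).2), (boolPow (σ i).1 (Y i) ^ 2)⁻¹ := by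
  have h : ∀ (e : ℤ) (ε : Fin m → Bool), altTerm (e - 1) ε Y =
      altTerm e ε Y * ∏ i, (boolPow (ε i) (Y i))⁻¹ := by
    intro e ε
    have : ∏ i, boolPow (ε i) (Y i) ^ (e - 1) =
        (∏ i, boolPow (ε i) (Y i) ^ e) * ∏ i, (boolPow (ε i) (Y i))⁻¹ := by
      rw [← prod_mul_distrib]
      exact prod_congr rfl fun i _ => zpow_sub_one₀ (boolPow_pos _ (hY i)).ne' _
    rw [altTerm, altTerm, this]; ring
  rw [pairTerm, pairTerm, h, show z - 1 + 1 = z + 1 - 1 by ring, h, prod_filter]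
  have : (∏ i, (boolPow (σ i).1 (Y i))⁻¹) * (∏ i, (boolPow (σ i).2 (Y i))⁻¹) =
      ∏ i, if (σ i).1 = (σ i).2 then (boolPow (σ i).1 (Y i) ^ 2)⁻¹ else 1 := by
    rw [← prod_mul_distrib]
    refine prod_congr rfl fun i _ => ?_
    have := hY i
    have h0 : Y i ≠ 0 := by linarith
    rcases σ i with ⟨a, b⟩
    cases a <;> cases b <;> simp [boolPow, h0, sq]
  rw [← this]; ring

/-- With `T` the set of positions of equal signs and `w_i = Y_i^{±2}`, the left side is `pairTerm z
σ Y` times `1 - ∏_{i ∈ T} w_i⁻¹`, which `sum_partialFraction` expands over `T`. The partial fraction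
factors are exactly what makes the coefficient of the `i`-th term independent of the signs at the
other positions, so that the sum over `σ` factors afterwards. -/
theorem alt_recurrence_term {m : ℕ} (z : ℤ) (σ : Fin (m + 1) → Bool × Bool)
    (Y : Fin (m + 1) → ℝ) (hY : ∀ i, 1 < Y i) (hinj : Function.Injective Y) :
    pairTerm z σ Y - pairTerm (z - 1) σ Y =
      ∑ i, if (σ i).1 = (σ i).2 then
        boolPow (σ i).1 (Y i) ^ (2 * (z + m)) * (Y i - (Y i)⁻¹) *
          (∏ k, (sqSum (Y i) - sqSum (Y (i.succAbove k)))) *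
          pairTerm z (σ ∘ i.succAbove) (Y ∘ i.succAbove) else 0 := by
  rw [pairTerm_pred z σ Y hY, ← sum_filter]
  set T := univ.filter (fun i => (σ i).1 = (σ i).2) with hT
  set w : Fin (m + 1) → ℝ := fun i => boolPow (σ i).1 (Y i) ^ 2 with hw
  have hpf := sum_partialFraction T w (fun i _ => pow_pos (boolPow_pos _ (hY i)) 2) (by
    intro i _ j _ hij
    by_contra hne
    exact boolPow_sq_ne _ _ (hY i) (hY j) (fun h => hne (hinj h)) hij)
  have : pairTerm z σ Y - pairTerm z σ Y * ∏ i ∈ T, (w i)⁻¹ =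
      pairTerm z σ Y * (1 - ∏ i ∈ T, (w i)⁻¹) := by ring
  rw [this, ← hpf, mul_sum]
  refine sum_congr rfl fun i hi => ?_
  have hσ : (σ i).1 = (σ i).2 := (mem_filter.1 hi).2
  rw [pairTerm_succAbove z σ Y i, ← hσ]
  have hprod : ∏ k ∈ T.erase i, ((w i - (w k)⁻¹) / (w i - w k)) =
      ∏ k : Fin m, if i.succAbove k ∈ T then
        ((w i - (w (i.succAbove k))⁻¹) / (w i - w (i.succAbove k))) else 1 := by
    have h1 : ∏ k ∈ T.erase i, ((w i - (w k)⁻¹) / (w i - w k)) =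
        ∏ k, if k ∈ T.erase i then ((w i - (w k)⁻¹) / (w i - w k)) else 1 := by
      rw [← prod_filter]; congr 1; ext; simp
    rw [h1, Fin.prod_univ_succAbove _ i]
    simp [Fin.succAbove_ne]
  have hb := boolPow_pos (σ i).1 (hY i)
  have hwi : w i ≠ 0 := (pow_pos hb 2).ne'
  have hfac : ∏ k, (sqSum (Y i) - sqSum (Y (i.succAbove k))) =
      (∏ k : Fin m, (w i)⁻¹) * (∏ k, ((boolPow (σ i).1 (Y i) ^ 2 -
        boolPow (σ (i.succAbove k)).1 (Y (i.succAbove k)) ^ 2) *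
        (boolPow (σ i).1 (Y i) ^ 2 - boolPow (σ (i.succAbove k)).2 (Y (i.succAbove k)) ^ 2))) *
      ∏ k ∈ T.erase i, ((w i - (w k)⁻¹) / (w i - w k)) := by
    rw [hprod, ← prod_mul_distrib, ← prod_mul_distrib]
    refine prod_congr rfl fun k _ => ?_
    set k' := i.succAbove k
    have hk := boolPow_pos (σ k').1 (hY k')
    have hwk : w k' ≠ 0 := (pow_pos hk 2).ne'
    have hne : w i - w k' ≠ 0 := sub_ne_zero.2 (boolPow_sq_ne _ _ (hY i) (hY k')
      fun h => Fin.succAbove_ne i k (hinj h).symm)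
    rw [sqSum_boolPow (σ i).1 (Y i), sqSum_boolPow (σ k').1 (Y k')]
    change w i + (w i)⁻¹ - (w k' + (w k')⁻¹) = _
    -- In both cases the target is `w_i⁻¹ (w_i - w_k)(w_i - w_k⁻¹)`. For `k ∈ T` the partial
    -- fraction factor converts one of two equal factors `w_i - w_k`; for `k ∉ T` the opposite signs
    -- supply `w_i - w_k⁻¹` directly.
    split_ifs with hkT
    · have : (σ k').2 = (σ k').1 := ((mem_filter.1 hkT).2).symm
      rw [this]
      change _ = (w i)⁻¹ * ((w i - w k') * (w i - w k')) * _
      field_simp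
      ring
    · have hne2 : (σ k').1 ≠ (σ k').2 := fun h => hkT (mem_filter.2 ⟨mem_univ _, h⟩)
      have : boolPow (σ k').2 (Y k') ^ 2 = (w k')⁻¹ := by
        simp only [hw]
        revert hne2
        rcases σ k' with ⟨a, b⟩
        cases a <;> cases b <;> simp [boolPow]
      rw [this]
      change _ = (w i)⁻¹ * ((w i - w k') * (w i - (w k')⁻¹)) * _
      field_simp
      ring
  rw [hfac, prod_const, card_univ, Fintype.card_fin]
  have hsg : Y i - (Y i)⁻¹ = boolSign (σ i).1 *
      (boolPow (σ i).1 (Y i) - (boolPow (σ i).1 (Y i))⁻¹) := by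
    cases (σ i).1 <;> simp [boolSign, boolPow]
  have hpow : boolPow (σ i).1 (Y i) ^ (2 * (z + m)) =
      boolPow (σ i).1 (Y i) ^ z * boolPow (σ i).1 (Y i) ^ z * (w i) ^ m := by
    rw [← zpow_add₀ hb.ne', hw]
    simp only []
    rw [← pow_mul, ← zpow_natCast, ← zpow_add₀ hb.ne']
    congr 1
    push_cast; ring
  rw [hsg, hpow, zpow_add_one₀ hb.ne']
  have hw2 : w i = boolPow (σ i).1 (Y i) ^ 2 := rfl
  have hw3 : (w i) ^ m * (w i)⁻¹ ^ m = 1 := by rw [← mul_pow, mul_inv_cancel₀ hwi, one_pow]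
  generalize (∏ k, ((boolPow (σ i).1 (Y i) ^ 2 -
        boolPow (σ (i.succAbove k)).1 (Y (i.succAbove k)) ^ 2) *
        (boolPow (σ i).1 (Y i) ^ 2 -
          boolPow (σ (i.succAbove k)).2 (Y (i.succAbove k)) ^ 2))) = Q at *
  generalize ∏ k ∈ T.erase i, ((w i - (w k)⁻¹) / (w i - w k)) = R at *
  generalize pairTerm z (σ ∘ i.succAbove) (Y ∘ i.succAbove) = E at *
  generalize w i = W at *
  subst hw2
  generalize boolPow (σ i).1 (Y i) = b at *
  have hb0 := hb.ne'
  have hbb : (1 - (b ^ 2)⁻¹) * b = b - b⁻¹ := by field_simp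
  calc _ = boolSign (σ i).1 * b ^ z * b ^ z * Q * E * R * ((1 - (b ^ 2)⁻¹) * b) := by ring
    _ = boolSign (σ i).1 * b ^ z * b ^ z * Q * E * R * (b - b⁻¹) *
        ((b ^ 2) ^ m * (b ^ 2)⁻¹ ^ m) := by rw [hbb, hw3, mul_one]
    _ = _ := by ring

/-- Summing `alt_recurrence_term` over sign patterns, the two possible common signs at `i` give the
two powers of `Y i`, and the signs elsewhere reassemble the product of alternants in the other
variables. -/
theorem alt_recurrence {m : ℕ} (z : ℤ) (Y : Fin (m + 1) → ℝ) (hY : ∀ i, 1 < Y i)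
    (hinj : Function.Injective Y) :
    oddAlt z Y * evenAlt (z + 1) Y - oddAlt (z - 1) Y * evenAlt z Y =
      ∑ i, (Y i ^ (2 * (z + m)) + (Y i)⁻¹ ^ (2 * (z + m))) * (Y i - (Y i)⁻¹) *
        (∏ k, (sqSum (Y i) - sqSum (Y (i.succAbove k)))) *
        (oddAlt z (Y ∘ i.succAbove) * evenAlt (z + 1) (Y ∘ i.succAbove)) := by
  have h1 : oddAlt (z - 1) Y * evenAlt z Y = ∑ σ, pairTerm (z - 1) σ Y := by
    rw [← oddAlt_mul_evenAlt, sub_add_cancel]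
  rw [h1, oddAlt_mul_evenAlt, ← sum_sub_distrib,
    sum_congr rfl fun σ _ => alt_recurrence_term z σ Y hY hinj, sum_comm]
  refine sum_congr rfl fun i _ => ?_
  rw [oddAlt_mul_evenAlt, ← (Fin.insertNthEquiv (fun _ => Bool × Bool) i).sum_comp,
    Fintype.sum_prod_type]
  simp only [Fin.insertNthEquiv_apply, Fin.insertNth_apply_same, Function.comp_def,
    Fin.insertNth_apply_succAbove]
  rw [Fintype.sum_prod_type]
  simp only [Fintype.sum_bool, boolPow]
  simp [← sum_add_distrib, mul_sum]
  refine sum_congr rfl fun σ _ => ?_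
  ring

/-- Each row is a sum of two geometric rows. Multilinearity expands the determinant over the
choices, and each choice gives a Vandermonde determinant in the squares. -/
theorem det_sum_boolPow {m : ℕ} (c : Bool → ℝ) (z : ℤ) (Y : Fin m → ℝ) (hY : ∀ i, 1 < Y i) :
    Matrix.det (Matrix.of fun i j : Fin m =>
      c true * Y i ^ (z + 2 * (j : ℤ)) + c false * (Y i)⁻¹ ^ (z + 2 * (j : ℤ))) =
    ∑ ε : Fin m → Bool, (∏ i, c (ε i)) * altTerm z ε Y := by
  have h1 : (Matrix.of fun i j : Fin m =>
      c true * Y i ^ (z + 2 * (j : ℤ)) + c false * (Y i)⁻¹ ^ (z + 2 * (j : ℤ))) =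
      fun i => ∑ b : Bool, fun j : Fin m => c b * boolPow b (Y i) ^ (z + 2 * (j : ℤ)) := by
    ext i j
    simp [boolPow]
  have h2 := (Matrix.detRowAlternating (R := ℝ) (n := Fin m)).toMultilinearMap.map_sum
    (fun (i : Fin m) (b : Bool) (j : Fin m) => c b * boolPow b (Y i) ^ (z + 2 * (j : ℤ)))
  rw [h1]
  refine h2.trans (sum_congr rfl fun ε _ => ?_)
  have h3 : (fun i (j : Fin m) => c (ε i) * boolPow (ε i) (Y i) ^ (z + 2 * (j : ℤ))) =
      Matrix.of fun i j => (c (ε i) * boolPow (ε i) (Y i) ^ z) *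
        Matrix.vandermonde (fun i => boolPow (ε i) (Y i) ^ 2) i j := by
    ext i j
    rw [Matrix.of_apply, Matrix.vandermonde_apply, zpow_add₀ (boolPow_pos _ (hY i)).ne', mul_assoc,
      ← pow_mul, ← zpow_natCast]
    push_cast
    rfl
  change Matrix.det (fun i (j : Fin m) => c (ε i) * boolPow (ε i) (Y i) ^ (z + 2 * (j : ℤ))) = _
  rw [h3, Matrix.det_mul_column, Matrix.det_vandermonde, prod_mul_distrib, altTerm, vdm, mul_assoc]

theorem oddAlt_eq_det {m : ℕ} (z : ℤ) (Y : Fin m → ℝ) (hY : ∀ i, 1 < Y i) :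
    oddAlt z Y = Matrix.det (Matrix.of fun i j : Fin m =>
      Y i ^ (z + 2 * (j : ℤ)) - (Y i)⁻¹ ^ (z + 2 * (j : ℤ))) := by
  rw [oddAlt, ← det_sum_boolPow boolSign z Y hY]
  congr 1
  ext i j
  simp [boolSign, sub_eq_add_neg]

theorem evenAlt_eq_det {m : ℕ} (z : ℤ) (Y : Fin m → ℝ) (hY : ∀ i, 1 < Y i) :
    evenAlt z Y = Matrix.det (Matrix.of fun i j : Fin m =>
      Y i ^ (z + 2 * (j : ℤ)) + (Y i)⁻¹ ^ (z + 2 * (j : ℤ))) := by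
  have := det_sum_boolPow (fun _ => 1) z Y hY
  simp only [one_mul, prod_const_one] at this
  rw [evenAlt, ← this]

/-- The exponents run symmetrically from `-m` to `m`, so the first and last columns are opposite. -/
theorem oddAlt_neg_eq_zero {m : ℕ} (Y : Fin (m + 1) → ℝ) (hY : ∀ i, 1 < Y i) :
    oddAlt (-(m : ℤ)) Y = 0 := by
  rw [oddAlt_eq_det _ _ hY]
  refine Matrix.exists_mulVec_eq_zero_iff.1
    ⟨Pi.single 0 1 + Pi.single (Fin.last m) 1, fun h => ?_, ?_⟩
  · have := congrFun h 0
    -- For `m = 0` the two columns coincide: the vector is `2` at the only index, and the column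
    -- itself is zero.
    by_cases h0 : (0 : Fin (m + 1)) = Fin.last m
    · rw [← h0] at this; norm_num at this
    · simp [Pi.single_eq_of_ne h0] at this
  · ext i
    rw [Matrix.mulVec_add, Matrix.mulVec_single_one, Matrix.mulVec_single_one]
    simp only [Pi.add_apply, Matrix.col_apply, Matrix.of_apply, Fin.val_zero, Fin.val_last,
      Pi.zero_apply]
    rw [show -(m : ℤ) + 2 * (m : ℤ) = m by ring, show -(m : ℤ) + 2 * ((0 : ℕ) : ℤ) = -m by simp]
    simp only [zpow_neg, inv_zpow', inv_inv]
    ring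

/-! ### The bounded determinant sum -/

/-- The sum over `1 ≤ b_1 < ⋯ < b_m ≤ n` of `det (Y_i^{2b_j} + Y_i^{-2b_j})`. -/
def chainSum (n m : ℕ) (Y : Fin m → ℝ) : ℝ :=
  ∑ b ∈ (Fintype.piFinset fun _ : Fin m => Icc 1 n).filter StrictMono,
    Matrix.det (Matrix.of fun i j : Fin m => Y i ^ (2 * b j) + (Y i)⁻¹ ^ (2 * b j))

theorem chainSum_zero_right (n : ℕ) (Y : Fin 0 → ℝ) : chainSum n 0 Y = 1 := by
  have : (Fintype.piFinset fun _ : Fin 0 => Icc 1 n).filter StrictMono = {Fin.elim0} := by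
    ext b
    simp only [mem_filter, Fintype.mem_piFinset, mem_singleton]
    exact ⟨fun _ => Subsingleton.elim _ _, fun _ => ⟨fun i => i.elim0, fun i => i.elim0⟩⟩
  rw [chainSum, this, sum_singleton, Matrix.det_fin_zero]

theorem chainSum_zero_left (m : ℕ) (Y : Fin (m + 1) → ℝ) : chainSum 0 (m + 1) Y = 0 := by
  rw [chainSum]
  refine sum_eq_zero fun b hb => ?_
  have := (Fintype.mem_piFinset.1 (mem_filter.1 hb).1) 0
  simp at this

theorem strictMono_snoc {m N : ℕ} {b : Fin m → ℕ} (hb : StrictMono b) (h : ∀ i, b i < N) :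
    StrictMono (Fin.snoc b N : Fin (m + 1) → ℕ) := by
  intro i j hij
  induction j using Fin.lastCases with
  | last =>
    induction i using Fin.lastCases with
    | last => exact absurd hij (lt_irrefl _)
    | cast i => simpa using h i
  | cast j =>
    induction i using Fin.lastCases with
    | last => exact absurd hij (not_lt.2 (Fin.le_last _))
    | cast i => simpa using hb (by simpa using hij)

/-- Chains either stay within `{1, …, n}` or end in `n + 1`. In the second case the determinant is
expanded along its last column. -/
theorem chainSum_succ (n m : ℕ) (Y : Fin (m + 1) → ℝ) :
    chainSum (n + 1) (m + 1) Y = chainSum n (m + 1) Y +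
      ∑ i : Fin (m + 1), (-1) ^ ((i : ℕ) + m) * (Y i ^ (2 * (n + 1)) + (Y i)⁻¹ ^ (2 * (n + 1))) *
        chainSum n m (Y ∘ i.succAbove) := by
  rw [chainSum, ← sum_filter_add_sum_filter_not _ fun b => b (Fin.last m) ≤ n]
  congr 1
  · rw [chainSum]
    refine sum_congr ?_ fun _ _ => rfl
    ext b
    simp only [mem_filter, Fintype.mem_piFinset, mem_Icc]
    constructor
    · rintro ⟨⟨h1, h2⟩, h3⟩
      exact ⟨fun i => ⟨(h1 i).1, (h2.monotone (Fin.le_last i)).trans h3⟩, h2⟩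
    · rintro ⟨h1, h2⟩
      exact ⟨⟨fun i => ⟨(h1 i).1, (h1 i).2.trans n.le_succ⟩, h2⟩, (h1 _).2⟩
  · simp only [chainSum, mul_sum]
    rw [sum_comm]
    refine sum_bij' (fun b _ => Fin.init b) (fun b _ => Fin.snoc b (n + 1)) ?_ ?_ ?_ ?_ ?_
    · intro b hb
      simp only [mem_filter, Fintype.mem_piFinset, mem_Icc] at hb ⊢
      obtain ⟨⟨h1, h2⟩, h3⟩ := hb
      refine ⟨fun i => ⟨(h1 _).1, ?_⟩, fun i j hij => h2 (by simpa using hij)⟩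
      have h4 := h2 (Fin.castSucc_lt_last i)
      have h5 := (h1 (Fin.last m)).2
      change b i.castSucc ≤ n
      omega
    · intro b hb
      simp only [mem_filter, Fintype.mem_piFinset, mem_Icc] at hb ⊢
      obtain ⟨h1, h2⟩ := hb
      refine ⟨⟨fun i => ?_, strictMono_snoc h2 fun i => Nat.lt_succ_of_le (h1 i).2⟩, by simp⟩
      induction i using Fin.lastCases with
      | last => simp
      | cast i => simpa using ⟨(h1 i).1, (h1 i).2.trans n.le_succ⟩
    · intro b hb
      simp only [mem_filter, Fintype.mem_piFinset, mem_Icc] at hb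
      have : b (Fin.last m) = n + 1 := by have := (hb.1.1 (Fin.last m)).2; omega
      rw [← this, Fin.snoc_init_self]
    · intro b _
      exact Fin.init_snoc _ _
    · intro b hb
      simp only [mem_filter, Fintype.mem_piFinset, mem_Icc] at hb
      have : b (Fin.last m) = n + 1 := by have := (hb.1.1 (Fin.last m)).2; omega
      rw [Matrix.det_succ_column _ (Fin.last m)]
      refine sum_congr rfl fun i _ => ?_
      rw [Matrix.of_apply, this, Fin.val_last]
      congr 2
      ext k l
      simp [Fin.init]

/-- Induction on `n` for all `m` at once. Multiplied by the common denominator, the column expansion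
of `chainSum_succ` becomes term by term the recurrence `alt_recurrence` at `z = n - m + 1`. -/
theorem chainSum_mul_eq (n : ℕ) : ∀ (m : ℕ) (Y : Fin m → ℝ), (∀ i, 1 < Y i) →
    Function.Injective Y →
    chainSum n m Y * (∏ i, (Y i - (Y i)⁻¹)) * vdm (sqSum ∘ Y) =
      oddAlt ((n : ℤ) - m + 1) Y * evenAlt ((n : ℤ) - m + 2) Y := by
  have h0 : ∀ (n : ℕ) (Y : Fin 0 → ℝ),
      chainSum n 0 Y * (∏ i, (Y i - (Y i)⁻¹)) * vdm (sqSum ∘ Y) =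
        oddAlt ((n : ℤ) - (0 : ℕ) + 1) Y * evenAlt ((n : ℤ) - (0 : ℕ) + 2) Y := by
    intro n Y
    simp [chainSum_zero_right, oddAlt, evenAlt, altTerm, vdm]
  induction n with
  | zero =>
    intro m Y hY _
    cases m with
    | zero => exact h0 0 Y
    | succ m =>
      -- No nonempty chain exists for `n = 0`; correspondingly the odd alternant has `z = -m` and
      -- vanishes.
      rw [chainSum_zero_left, show ((0 : ℕ) : ℤ) - (m + 1 : ℕ) + 1 = -(m : ℤ) by push_cast; ring,
        oddAlt_neg_eq_zero Y hY]
      simp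
  | succ n ih =>
    intro m Y hY hinj
    cases m with
    | zero => exact h0 (n + 1) Y
    | succ m =>
      have hrec := alt_recurrence ((n : ℤ) - m + 1) Y hY hinj
      have h1 := ih (m + 1) Y hY hinj
      rw [show ((n + 1 : ℕ) : ℤ) - (m + 1 : ℕ) + 1 = (n : ℤ) - m + 1 by push_cast; ring,
        show ((n + 1 : ℕ) : ℤ) - (m + 1 : ℕ) + 2 = (n : ℤ) - m + 1 + 1 by push_cast; ring,
        chainSum_succ, add_mul, add_mul, h1,
        show (n : ℤ) - (m + 1 : ℕ) + 1 = (n : ℤ) - m + 1 - 1 by push_cast; ring,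
        show (n : ℤ) - (m + 1 : ℕ) + 2 = (n : ℤ) - m + 1 by push_cast; ring,
        ← eq_sub_iff_add_eq', hrec, sum_mul, sum_mul]
      refine sum_congr rfl fun i _ => ?_
      have h2 := ih m (Y ∘ i.succAbove) (fun k => hY _) (hinj.comp Fin.succAbove_right_injective)
      rw [show (n : ℤ) - m + 1 + 1 = (n : ℤ) - m + 2 by ring, ← h2, vdm_succAbove _ i,
        Fin.prod_univ_succAbove _ i]
      have h5 : ((-1 : ℝ) ^ ((i : ℕ) + m)) * (-1) ^ ((i : ℕ) + m) = 1 := by rw [← mul_pow]; simp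
      have e1 : ∀ y : ℝ, y ^ (2 * ((n : ℤ) - m + 1 + m)) = y ^ (2 * (n + 1)) := fun y => by
        rw [← zpow_natCast]; congr 1; push_cast; ring
      rw [e1, e1]
      simp only [Function.comp_def]
      generalize (-1 : ℝ) ^ ((i : ℕ) + m) = e at *
      generalize chainSum n m _ = S
      generalize vdm _ = V
      generalize (∏ k, (sqSum (Y i) - sqSum (Y (i.succAbove k)))) = Q
      generalize Y i ^ (2 * (n + 1)) + (Y i)⁻¹ ^ (2 * (n + 1)) = f
      linear_combination (f * S * (Y i - (Y i)⁻¹) * (∏ k, (Y (i.succAbove k) -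
        (Y (i.succAbove k))⁻¹)) * Q * V) * h5

/-! ### Specialization to odd powers -/

/-- The monic polynomials with
`c^{2i+1} + τ c^{-(2i+1)} = (c + τ c⁻¹) V_i(c² + c⁻²)` for `τ = ±1`. -/
def oddCheb (τ : ℝ) : ℕ → Polynomial ℝ
  | 0 => 1
  | 1 => Polynomial.X - Polynomial.C τ
  | i + 2 => Polynomial.X * oddCheb τ (i + 1) - oddCheb τ i

theorem oddCheb_monic_natDegree (τ : ℝ) (i : ℕ) :
    ((oddCheb τ i).Monic ∧ (oddCheb τ i).natDegree = i) ∧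
      ((oddCheb τ (i + 1)).Monic ∧ (oddCheb τ (i + 1)).natDegree = i + 1) := by
  induction i with
  | zero =>
    exact ⟨⟨Polynomial.monic_one, Polynomial.natDegree_one⟩, Polynomial.monic_X_sub_C τ,
      Polynomial.natDegree_X_sub_C τ⟩
  | succ i ih =>
    obtain ⟨⟨h1, h2⟩, h3, h4⟩ := ih
    refine ⟨⟨h3, h4⟩, ?_⟩
    have hX : (Polynomial.X * oddCheb τ (i + 1)).Monic := Polynomial.monic_X.mul h3
    have hXd : (Polynomial.X * oddCheb τ (i + 1)).natDegree = i + 1 + 1 := by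
      rw [Polynomial.monic_X.natDegree_mul h3, Polynomial.natDegree_X, h4, add_comm]
    have hlt : (oddCheb τ i).degree < (Polynomial.X * oddCheb τ (i + 1)).degree := by
      rw [Polynomial.degree_eq_natDegree h1.ne_zero, Polynomial.degree_eq_natDegree hX.ne_zero,
        h2, hXd]
      exact_mod_cast (by omega : i < i + 1 + 1)
    refine ⟨hX.sub_of_left hlt, ?_⟩
    rw [oddCheb, Polynomial.natDegree_sub_eq_left_of_natDegree_lt, hXd]
    rw [h2, hXd]; omega

theorem oddCheb_eval (τ : ℝ) (hτ : τ * τ = 1) (c : ℝ) (hc : c ≠ 0) (i : ℕ) :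
    c ^ (2 * i + 1) + τ * c⁻¹ ^ (2 * i + 1) =
        (c + τ * c⁻¹) * (oddCheb τ i).eval (sqSum c) ∧
      c ^ (2 * (i + 1) + 1) + τ * c⁻¹ ^ (2 * (i + 1) + 1) =
        (c + τ * c⁻¹) * (oddCheb τ (i + 1)).eval (sqSum c) := by
  have hcc : c * c⁻¹ = 1 := mul_inv_cancel₀ hc
  induction i with
  | zero =>
    refine ⟨by simp [oddCheb], ?_⟩
    simp only [oddCheb, Polynomial.eval_sub, Polynomial.eval_X, Polynomial.eval_C, sqSum]
    generalize c⁻¹ = d at *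
    linear_combination (-d - τ * c) * hcc + d * hτ
  | succ i ih =>
    refine ⟨ih.2, ?_⟩
    obtain ⟨h1, h2⟩ := ih
    simp only [oddCheb, Polynomial.eval_sub, Polynomial.eval_mul, Polynomial.eval_X]
    rw [mul_sub, ← h1, mul_left_comm, ← h2]
    simp only [sqSum]
    generalize c⁻¹ = d at *
    have e1 : c ^ (2 * (i + 1) + 1) * d ^ 2 = c ^ (2 * i + 1) := by
      rw [show c ^ (2 * (i + 1) + 1) * d ^ 2 = c ^ (2 * i + 1) * (c * d) ^ 2 by ring, hcc]; ring
    have e2 : d ^ (2 * (i + 1) + 1) * c ^ 2 = d ^ (2 * i + 1) := by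
      rw [show d ^ (2 * (i + 1) + 1) * c ^ 2 = d ^ (2 * i + 1) * (c * d) ^ 2 by ring, hcc]; ring
    linear_combination -e1 - τ * e2

/-- After removal of `c_j + τ c_j⁻¹` from each column, row `i` consists of values of a monic
polynomial of degree `i` in `c² + c⁻²`, so the rest is a Vandermonde determinant. -/
theorem det_odd_powers {m : ℕ} (τ : ℝ) (hτ : τ * τ = 1) (c : Fin m → ℝ) (hc : ∀ j, c j ≠ 0) :
    Matrix.det (Matrix.of fun i j : Fin m =>
      c j ^ (2 * (i : ℕ) + 1) + τ * (c j)⁻¹ ^ (2 * (i : ℕ) + 1)) =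
    (∏ j, (c j + τ * (c j)⁻¹)) * vdm (sqSum ∘ c) := by
  have h1 : (Matrix.of fun i j : Fin m =>
      c j ^ (2 * (i : ℕ) + 1) + τ * (c j)⁻¹ ^ (2 * (i : ℕ) + 1)) =
      Matrix.of fun i j => (c j + τ * (c j)⁻¹) *
        (Matrix.of fun (j i : Fin m) => (oddCheb τ i).eval ((sqSum ∘ c) j)).transpose i j := by
    ext i j
    simpa using (oddCheb_eval τ hτ (c j) (hc j) i).1
  rw [h1, Matrix.det_mul_row, Matrix.det_transpose,
    ← Matrix.det_eval_matrixOfPolynomials_eq_det_vandermonde _ (fun i : Fin m => oddCheb τ i)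
      (fun i => (oddCheb_monic_natDegree τ i).1.2) (fun i => (oddCheb_monic_natDegree τ i).1.1),
    Matrix.det_vandermonde, vdm]

/-- `P^k - P^{-k}`. -/
def brm (P : ℝ) (k : ℕ) : ℝ := P ^ k - (P ^ k)⁻¹

/-- `P^k + P^{-k}`. -/
def brp (P : ℝ) (k : ℕ) : ℝ := P ^ k + (P ^ k)⁻¹

theorem sqSum_pow_sub {P : ℝ} (hP : P ≠ 0) {a b : ℕ} (h : a ≤ b) :
    sqSum (P ^ b) - sqSum (P ^ a) = brm P (b - a) * brm P (b + a) := by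
  obtain ⟨d, rfl⟩ := Nat.exists_eq_add_of_le h
  rw [Nat.add_sub_cancel_left]
  simp only [sqSum, brm]
  field_simp
  ring

/-- At `Y_i = P^{2i+1}` the entries are `P^{(2i+1)e} ± P^{-(2i+1)e}`, which are also odd powers of
`P^e`. Read this way, each of the three kinds of determinants in `chainSum_mul_eq` is evaluated by
`det_odd_powers`, with `e = 2b_j`, `r + 1 + 2j` and `r + 2 + 2j`. -/
theorem chainSum_odd_powers {P : ℝ} (hP : 1 < P) (m r : ℕ) :
    (∑ b ∈ (Fintype.piFinset fun _ : Fin m => Icc 1 (m + r)).filter StrictMono,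
      (∏ j, brp P (2 * b j)) * vdm fun j => sqSum (P ^ (2 * b j))) *
      (∏ i : Fin m, brm P (2 * i + 1)) * (vdm fun i : Fin m => sqSum (P ^ (2 * (i : ℕ) + 1))) =
    ((∏ j : Fin m, brm P (r + 1 + 2 * j)) * vdm fun j : Fin m => sqSum (P ^ (r + 1 + 2 * (j : ℕ)))) *
    ((∏ j : Fin m, brp P (r + 2 + 2 * j)) *
      vdm fun j : Fin m => sqSum (P ^ (r + 2 + 2 * (j : ℕ)))) := by
  have hP0 : P ≠ 0 := by linarith
  have hY : ∀ i : Fin m, 1 < P ^ (2 * (i : ℕ) + 1) := fun i => one_lt_pow₀ hP (by omega)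
  have key := chainSum_mul_eq (m + r) m (fun i => P ^ (2 * (i : ℕ) + 1)) hY (by
    intro i j h
    have := pow_right_injective₀ (by linarith) hP.ne' h
    exact Fin.ext (by omega))
  rw [oddAlt_eq_det _ _ hY, evenAlt_eq_det _ _ hY] at key
  have e1 := det_odd_powers (-1) (by norm_num) (fun j : Fin m => P ^ (r + 1 + 2 * (j : ℕ)))
    (fun j => pow_ne_zero _ hP0)
  have e2 := det_odd_powers 1 (by norm_num) (fun j : Fin m => P ^ (r + 2 + 2 * (j : ℕ)))
    (fun j => pow_ne_zero _ hP0)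
  simp only [neg_one_mul, ← sub_eq_add_neg, one_mul] at e1 e2
  simp only [brm, brp]
  simp only [Function.comp_def] at e1 e2 key
  rw [← e1, ← e2]
  convert key using 4
  · rw [chainSum]
    refine sum_congr rfl fun b _ => ?_
    have e3 := det_odd_powers 1 (by norm_num) (fun j : Fin m => P ^ (2 * b j))
      (fun j => pow_ne_zero _ hP0)
    simp only [one_mul, Function.comp_def] at e3
    rw [← e3]
    congr 1
    ext i j
    simp only [Matrix.of_apply, ← pow_mul, inv_pow]
    rw [mul_comm (2 * b j)]
  · ext i j
    rw [show ((m + r : ℕ) : ℤ) - m + 1 + 2 * (j : ℤ) = ((r + 1 + 2 * j : ℕ) : ℤ) by push_cast; ring]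
    simp only [zpow_natCast, inv_pow, ← pow_mul]
    rw [mul_comm (r + 1 + 2 * (j : ℕ))]
  · ext i j
    rw [show ((m + r : ℕ) : ℤ) - m + 2 + 2 * (j : ℤ) = ((r + 2 + 2 * j : ℕ) : ℤ) by push_cast; ring]
    simp only [zpow_natCast, inv_pow, ← pow_mul]
    rw [mul_comm (r + 2 + 2 * (j : ℕ))]

theorem vdm_eq_prod_range (m : ℕ) (f : ℕ → ℝ) :
    (vdm fun i : Fin m => f i) = ∏ j ∈ range m, ∏ i ∈ range j, (f j - f i) := by
  induction m with
  | zero => simp [vdm]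
  | succ m ih =>
    rw [vdm_succAbove _ (Fin.last m), prod_range_succ, ← ih]
    have h5 : ((-1 : ℝ) ^ (m + m)) = 1 := by rw [← two_mul, pow_mul]; simp
    simp only [Fin.val_last, h5, one_mul, Fin.succAbove_last, Fin.val_castSucc, Function.comp_def]
    rw [mul_comm, prod_range]

/-! ### Sums over subsets and complementation -/

/-- The product of all `|x a - x b|` with `a, b ∈ A`, `b < a`. -/
def gapProd (x : ℕ → ℝ) (A : Finset ℕ) : ℝ := ∏ a ∈ A, ∏ b ∈ A with b < a, |x a - x b|

theorem gapProd_insert (x : ℕ → ℝ) {a : ℕ} {A : Finset ℕ} (ha : a ∉ A) :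
    gapProd x (insert a A) = (∏ b ∈ A, |x a - x b|) * gapProd x A := by
  rw [gapProd, prod_insert ha, filter_insert, if_neg (lt_irrefl a)]
  have h1 : ∀ c ∈ A, ∏ b ∈ insert a A with b < c, |x c - x b| =
      (if a < c then |x c - x a| else 1) * ∏ b ∈ A with b < c, |x c - x b| := by
    intro c _
    rw [filter_insert]
    split_ifs with h
    · rw [prod_insert (by simp [ha])]
    · rw [one_mul]
  rw [prod_congr rfl h1, prod_mul_distrib, ← mul_assoc, prod_filter, ← prod_mul_distrib, gapProd]
  congr 1
  refine prod_congr rfl fun b hb => ?_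
  have hne : b ≠ a := fun h => ha (h ▸ hb)
  rcases lt_or_gt_of_ne hne with h | h
  · simp [h, not_lt.2 h.le]
  · simp [h, not_lt.2 h.le, abs_sub_comm]

theorem prod_abs_eq_gapProd (x : ℕ → ℝ) : ∀ {r : ℕ} (k : Fin r → ℕ), Function.Injective k →
    ∏ i, ∏ j ∈ Ioi i, |x (k i) - x (k j)| = gapProd x (univ.image k)
  | 0, k, _ => by simp [gapProd]
  | r + 1, k, hk => by
    have h1 : univ.image k = insert (k 0) (univ.image fun i : Fin r => k i.succ) := by
      ext a
      simp [Fin.exists_fin_succ, eq_comm]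
    rw [h1, gapProd_insert, Fin.prod_univ_succ, Fin.prod_Ioi_zero,
      prod_image fun i _ j _ h => Fin.succ_injective _ (hk h),
      ← prod_abs_eq_gapProd x (fun i : Fin r => k i.succ)
        fun i j h => Fin.succ_injective _ (hk h)]
    · simp only [Fin.prod_Ioi_succ]
    · simp only [mem_image, mem_univ, true_and, not_exists]
      exact fun i h => absurd (hk h) (Fin.succ_ne_zero i)

theorem sum_strictMono_eq_sum_powersetCard (T : Finset ℕ) (m : ℕ) (h : Finset ℕ → ℝ) :
    ∑ b ∈ (Fintype.piFinset fun _ : Fin m => T).filter StrictMono, h (univ.image b) =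
      ∑ B ∈ T.powersetCard m, h B := by
  refine sum_bij (fun b _ => univ.image b) ?_ ?_ ?_ fun _ _ => rfl
  · intro b hb
    obtain ⟨h1, h2⟩ := mem_filter.1 hb
    rw [mem_powersetCard, card_image_of_injective _ h2.injective]
    refine ⟨?_, by simp⟩
    intro a ha
    obtain ⟨i, _, rfl⟩ := mem_image.1 ha
    exact Fintype.mem_piFinset.1 h1 i
  · intro b hb c hc hbc
    have hb' := (mem_filter.1 hb).2
    have hc' := (mem_filter.1 hc).2
    refine (StrictMono.range_inj hb' hc').1 ?_
    have := congrArg (fun s : Finset ℕ => (s : Set ℕ)) hbc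
    simpa using this
  · intro B hB
    obtain ⟨h1, h2⟩ := mem_powersetCard.1 hB
    refine ⟨B.orderEmbOfFin h2, mem_filter.2 ⟨Fintype.mem_piFinset.2 fun i =>
      h1 (orderEmbOfFin_mem _ _ _), (B.orderEmbOfFin h2).strictMono⟩, ?_⟩
    exact image_orderEmbOfFin_univ _ _

theorem brm_pos {P : ℝ} (hP : 1 < P) {k : ℕ} (hk : k ≠ 0) : 0 < brm P k := by
  have h := one_lt_pow₀ hP hk
  have := inv_lt_one_of_one_lt₀ h
  unfold brm; linarith

theorem brp_pos {P : ℝ} (hP : 1 < P) (k : ℕ) : 0 < brp P k := by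
  unfold brp; positivity

theorem sqSum_pow_strictMono {P : ℝ} (hP : 1 < P) : StrictMono fun a : ℕ => sqSum (P ^ (2 * a)) := by
  intro a b hab
  have := sqSum_pow_sub (P := P) (by linarith) (show 2 * a ≤ 2 * b by omega)
  have h1 := brm_pos hP (k := 2 * b - 2 * a) (by omega)
  have h2 := brm_pos hP (k := 2 * b + 2 * a) (by omega)
  have := mul_pos h1 h2
  dsimp only
  linarith

theorem sum_powersetCard_gapProd {P : ℝ} (hP : 1 < P) (n m : ℕ) :
    ∑ B ∈ (Icc 1 n).powersetCard m,
      (∏ b ∈ B, brp P (2 * b)) * gapProd (fun a => sqSum (P ^ (2 * a))) B =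
    ∑ b ∈ (Fintype.piFinset fun _ : Fin m => Icc 1 n).filter StrictMono,
      (∏ j, brp P (2 * b j)) * vdm fun j => sqSum (P ^ (2 * b j)) := by
  rw [← sum_strictMono_eq_sum_powersetCard]
  refine sum_congr rfl fun b hb => ?_
  have hb' := (mem_filter.1 hb).2
  rw [prod_image fun i _ j _ h => hb'.injective h,
    ← prod_abs_eq_gapProd (fun a => sqSum (P ^ (2 * a))) b hb'.injective, vdm]
  congr 1
  refine prod_congr rfl fun i _ => prod_congr rfl fun j hj => ?_
  have := sqSum_pow_strictMono hP (hb' (mem_Ioi.1 hj))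
  dsimp only at this ⊢
  rw [abs_sub_comm, abs_of_pos (by linarith)]

theorem gapProd_pos {x : ℕ → ℝ} (hx : Function.Injective x) (A : Finset ℕ) : 0 < gapProd x A :=
  prod_pos fun _ _ => prod_pos fun _ hb => abs_pos.2 (sub_ne_zero.2 fun h =>
    (mem_filter.1 hb).2.ne' (hx h))

/-- On both sides a pair inside `A` counts twice, while mixed pairs and pairs inside `U \ A` count
once. -/
theorem gapProd_compl (x : ℕ → ℝ) (U : Finset ℕ) (A : Finset ℕ) :
    A ⊆ U → gapProd x A * gapProd x U =
      gapProd x (U \ A) * ∏ a ∈ A, ∏ m ∈ U.erase a, |x a - x m| := by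
  induction A using Finset.induction_on with
  | empty => simp [gapProd]
  | insert a A ha ih =>
    intro hAU
    obtain ⟨haU, hA⟩ := insert_subset_iff.1 hAU
    have h1 : U \ A = insert a (U \ insert a A) := by
      ext b; simp only [mem_sdiff, mem_insert]
      by_cases hb : b = a
      · subst hb; simp [haU, ha]
      · simp [hb]
    have h2 : U.erase a = A ∪ (U \ insert a A) := by
      ext b; simp only [mem_erase, mem_union, mem_sdiff, mem_insert]
      by_cases hb : b = a
      · subst hb; simp [ha]
      · have : b ∈ A → b ∈ U := fun h => hA h
        tauto
    have h3 : Disjoint A (U \ insert a A) :=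
      disjoint_left.2 fun b hb hb' => (mem_sdiff.1 hb').2 (mem_insert_of_mem hb)
    have ih' := ih hA
    rw [h1, gapProd_insert x (by simp)] at ih'
    rw [gapProd_insert x ha, prod_insert ha, h2, prod_union h3, mul_assoc, ih']
    ring

theorem sum_powersetCard_compl (U : Finset ℕ) (m r : ℕ) (hU : #U = m + r) (f : Finset ℕ → ℝ) :
    ∑ A ∈ U.powersetCard r, f (U \ A) = ∑ B ∈ U.powersetCard m, f B := by
  refine sum_bij' (fun A _ => U \ A) (fun B _ => U \ B) ?_ ?_ ?_ ?_ fun _ _ => rfl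
  · intro A hA
    obtain ⟨h1, h2⟩ := mem_powersetCard.1 hA
    exact mem_powersetCard.2 ⟨sdiff_subset, by rw [card_sdiff_of_subset h1]; omega⟩
  · intro A hA
    obtain ⟨h1, h2⟩ := mem_powersetCard.1 hA
    exact mem_powersetCard.2 ⟨sdiff_subset, by rw [card_sdiff_of_subset h1]; omega⟩
  · intro A hA
    exact Finset.sdiff_sdiff_eq_self (mem_powersetCard.1 hA).1
  · intro A hA
    exact Finset.sdiff_sdiff_eq_self (mem_powersetCard.1 hA).1

theorem card_filter_image_eq (T B : Finset ℕ) (r : ℕ) (hB : B ∈ T.powersetCard r) :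
    #({k ∈ Fintype.piFinset fun _ : Fin r => T | Function.Injective k ∧ univ.image k = B}) =
      r.factorial := by
  obtain ⟨h1, h2⟩ := mem_powersetCard.1 hB
  have h3 : Fintype.card (Fin r ↪ B) = r.factorial := by
    rw [Fintype.card_embedding_eq, Fintype.card_coe, h2, Fintype.card_fin, Nat.descFactorial_self]
  rw [← h3, ← card_univ]
  symm
  refine card_bij (fun e _ i => (e i : ℕ)) ?_ ?_ ?_
  · intro e _
    have hinj : Function.Injective fun i => (e i : ℕ) := Subtype.val_injective.comp e.injective
    refine mem_filter.2 ⟨Fintype.mem_piFinset.2 fun i => h1 (e i).2, hinj, ?_⟩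
    refine eq_of_subset_of_card_le ?_ ?_
    · intro a ha
      obtain ⟨i, _, rfl⟩ := mem_image.1 ha
      exact (e i).2
    · rw [card_image_of_injective _ hinj, h2]; simp
  · intro e _ e' _ h
    ext i
    exact congrFun h i
  · intro k hk
    obtain ⟨_, hinj, him⟩ := mem_filter.1 hk
    refine ⟨⟨fun i => ⟨k i, him ▸ mem_image_of_mem _ (mem_univ i)⟩, fun i j h => hinj ?_⟩,
      mem_univ _, rfl⟩
    simpa using h

/-- Tuples with a repeated entry contribute zero, and every `r`-subset is the image of `r!`
injective tuples. -/
theorem sum_piFinset_gapProd (x w : ℕ → ℝ) (T : Finset ℕ) (r : ℕ) :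
    ∑ k ∈ Fintype.piFinset fun _ : Fin r => T,
      (∏ i, ∏ j ∈ Ioi i, |x (k i) - x (k j)|) * ∏ i, w (k i) =
    r.factorial * ∑ A ∈ T.powersetCard r, gapProd x A * ∏ a ∈ A, w a := by
  rw [← sum_filter_of_ne (p := Function.Injective)]
  · rw [← sum_fiberwise_of_maps_to (g := fun k => univ.image k) (t := T.powersetCard r), mul_sum]
    · refine sum_congr rfl fun B hB => ?_
      rw [filter_filter, ← card_filter_image_eq T B r hB, ← nsmul_eq_mul, ← sum_const]
      refine sum_congr rfl fun k hk => ?_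
      obtain ⟨_, hinj, him⟩ := mem_filter.1 hk
      rw [prod_abs_eq_gapProd x k hinj, him, ← him, prod_image fun i _ j _ h => hinj h]
    · intro k hk
      obtain ⟨h1, hinj⟩ := mem_filter.1 hk
      refine mem_powersetCard.2 ⟨?_, by rw [card_image_of_injective _ hinj]; simp⟩
      intro a ha
      obtain ⟨i, _, rfl⟩ := mem_image.1 ha
      exact Fintype.mem_piFinset.1 h1 i
  · intro k _ hne i j hij
    by_contra hij'
    apply hne
    rcases lt_or_gt_of_ne hij' with h | h
    · rw [prod_eq_zero (mem_univ i) (prod_eq_zero (mem_Ioi.2 h) (by simp [hij])), zero_mul]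
    · rw [prod_eq_zero (mem_univ j) (prod_eq_zero (mem_Ioi.2 h) (by simp [hij])), zero_mul]

/-- Tuples with a zero entry contribute nothing; every other tuple of absolute values has `2^r` sign
lifts. -/
theorem sum_box_natAbs (r n : ℕ) (H : (Fin r → ℕ) → ℝ) (hH : ∀ a i, a i = 0 → H a = 0) :
    ∑ k ∈ box r n, H (fun i => (k i).natAbs) =
      2 ^ r * ∑ a ∈ Fintype.piFinset fun _ : Fin r => Icc 1 n, H a := by
  rw [← sum_fiberwise_of_maps_to (g := fun k i => (k i).natAbs)
    (t := Fintype.piFinset fun _ : Fin r => range (n + 1)), mul_sum]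
  · have hsub : (Fintype.piFinset fun _ : Fin r => Icc 1 n) ⊆
        Fintype.piFinset fun _ : Fin r => range (n + 1) :=
      Fintype.piFinset_subset _ _ fun _ a ha => by
        simp only [mem_Icc, mem_range] at ha ⊢; omega
    rw [← sum_subset hsub]
    · refine sum_congr rfl fun a ha => ?_
      have h1 : {k ∈ box r n | (fun i => (k i).natAbs) = a} =
          Fintype.piFinset fun i => ({(a i : ℤ), -(a i : ℤ)} : Finset ℤ) := by
        ext k
        simp only [box, mem_filter, Fintype.mem_piFinset, mem_insert, mem_singleton, mem_Icc,
          funext_iff] at ha ⊢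
        constructor
        · rintro ⟨h1, h2⟩ i
          have := h2 i; omega
        · intro h
          refine ⟨fun i => ?_, fun i => ?_⟩
          · have := h i; have := ha i; omega
          · have := h i; omega
      have h2 : #{k ∈ box r n | (fun i => (k i).natAbs) = a} = 2 ^ r := by
        rw [h1, Fintype.card_piFinset]
        have : ∀ i, #({(a i : ℤ), -(a i : ℤ)} : Finset ℤ) = 2 := fun i => by
          have := mem_Icc.1 (Fintype.mem_piFinset.1 ha i)
          exact card_pair (by omega)
        simp [this]
      have h3 : (2 : ℝ) ^ r = ((2 ^ r : ℕ) : ℝ) := by push_cast; rfl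
      rw [h3, ← h2, ← nsmul_eq_mul, ← sum_const]
      refine sum_congr rfl fun k hk => ?_
      rw [(mem_filter.1 hk).2]
    · intro a ha hna
      have : ∃ i, a i = 0 := by
        by_contra hcon
        push Not at hcon
        refine hna (Fintype.mem_piFinset.2 fun i => ?_)
        have := Fintype.mem_piFinset.1 ha i
        have := hcon i
        simp only [mem_Icc, mem_range] at *
        omega
      obtain ⟨i, hi⟩ := this
      refine sum_eq_zero fun k hk => ?_
      rw [(mem_filter.1 hk).2]
      exact hH a i hi
  · intro k hk
    simp only [box, Fintype.mem_piFinset, mem_Icc, mem_range] at hk ⊢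
    intro i
    have := hk i; omega

/-! ### Symmetric form of the `q`-summand -/

/-- `(q;q)_j`. -/
def qfac (q : ℝ) (j : ℕ) : ℝ := ∏ l ∈ range j, (1 - q ^ (l + 1))

theorem qfac_pos {q : ℝ} (h0 : 0 < q) (h1 : q < 1) (j : ℕ) : 0 < qfac q j :=
  prod_pos fun l _ => sub_pos.2 (pow_lt_one₀ h0.le h1 (Nat.succ_ne_zero l))

theorem qfac_succ (q : ℝ) (j : ℕ) : qfac q (j + 1) = qfac q j * (1 - q ^ (j + 1)) :=
  prod_range_succ _ _

theorem qPoch_natCast (a q : ℝ) (n : ℕ) : qPoch a q n = ∏ k ∈ range n, (1 - a * q ^ k) := rfl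

theorem qPoch_self (q : ℝ) (n : ℕ) : qPoch q q n = qfac q n := by
  rw [qPoch_natCast, qfac]
  exact prod_congr rfl fun _ _ => by ring

theorem qBinom_natCast {q : ℝ} (h0 : 0 < q) (h1 : q < 1) (a c : ℕ) :
    qBinom q ((a : ℤ) + c) a = qfac q (a + c) / (qfac q a * qfac q c) := by
  have e : qPoch (q ^ ((a : ℤ) + c - a + 1)) q a * qfac q c = qfac q (a + c) := by
    rw [qPoch_natCast, add_comm a c, qfac, qfac, prod_range_add, mul_comm]
    congr 1
    refine prod_congr rfl fun k _ => ?_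
    rw [show (a : ℤ) + c - a + 1 = ((c + 1 : ℕ) : ℤ) by push_cast; ring, zpow_natCast]
    ring
  rw [qBinom, qPoch_self, ← e]
  have := (qfac_pos h0 h1 a).ne'
  have := (qfac_pos h0 h1 c).ne'
  field_simp

theorem qBinom_central {q : ℝ} (h0 : 0 < q) (h1 : q < 1) (n : ℕ) (k : ℤ)
    (hk : k ∈ Icc (-(n : ℤ)) n) :
    qBinom q (2 * (n : ℤ)) ((n : ℤ) + k) =
      qfac q (2 * n) / (qfac q (n + k.natAbs) * qfac q (n - k.natAbs)) := by
  rw [mem_Icc] at hk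
  rcases Int.natAbs_eq k with h | h
  · rw [show (n : ℤ) + k = ((n + k.natAbs : ℕ) : ℤ) by omega,
      show 2 * (n : ℤ) = ((n + k.natAbs : ℕ) : ℤ) + ((n - k.natAbs : ℕ) : ℤ) by omega,
      qBinom_natCast h0 h1, show n + k.natAbs + (n - k.natAbs) = 2 * n by omega]
  · rw [show (n : ℤ) + k = ((n - k.natAbs : ℕ) : ℤ) by omega,
      show 2 * (n : ℤ) = ((n - k.natAbs : ℕ) : ℤ) + ((n + k.natAbs : ℕ) : ℤ) by omega,
      qBinom_natCast h0 h1, show n - k.natAbs + (n + k.natAbs) = 2 * n by omega,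
      mul_comm (qfac q (n - k.natAbs))]

theorem sqSum_natAbs (P : ℝ) (k : ℤ) :
    sqSum (P ^ (2 * k.natAbs)) = ((P ^ 4)⁻¹) ^ k + (((P ^ 4)⁻¹) ^ k)⁻¹ := by
  have h : ∀ a : ℕ, sqSum (P ^ (2 * a)) = ((P ^ 4)⁻¹) ^ a + (((P ^ 4)⁻¹) ^ a)⁻¹ := fun a => by
    simp only [sqSum, inv_pow, inv_inv, ← pow_mul]
    rw [show 2 * a * 2 = 4 * a by ring, add_comm]
  rw [h]
  rcases Int.natAbs_eq k with h | h
  · conv_rhs => rw [h]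
    rw [zpow_natCast]
  · conv_rhs => rw [h]
    rw [zpow_neg, zpow_natCast, inv_inv, add_comm]

theorem abs_qNum_mul {P : ℝ} (hP : 1 < P) (a b : ℤ) :
    |qNum (P ^ 4)⁻¹ (a - b) * qNum (P ^ 4)⁻¹ (a + b)| =
      ((1 - (P ^ 4)⁻¹) ^ 2)⁻¹ * ((P ^ 4)⁻¹) ^ a *
        |sqSum (P ^ (2 * a.natAbs)) - sqSum (P ^ (2 * b.natAbs))| := by
  have hP0 : P ≠ 0 := by linarith
  have hq : (P ^ 4)⁻¹ ≠ 0 := inv_ne_zero (pow_ne_zero _ hP0)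
  rw [sqSum_natAbs P, sqSum_natAbs P]
  have h1 : (0 : ℝ) ≤ ((1 - (P ^ 4)⁻¹) ^ 2)⁻¹ * ((P ^ 4)⁻¹) ^ a := by positivity
  rw [← abs_of_nonneg h1, ← abs_mul]
  congr 1
  simp only [qNum]
  rw [zpow_sub₀ hq, zpow_add₀ hq]
  have h2 : ((P ^ 4)⁻¹) ^ a ≠ 0 := zpow_ne_zero _ hq
  have h3 : ((P ^ 4)⁻¹) ^ b ≠ 0 := zpow_ne_zero _ hq
  generalize ((P ^ 4)⁻¹) ^ a = u at *
  generalize ((P ^ 4)⁻¹) ^ b = v at *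
  rw [div_mul_div_comm, ← sq, div_eq_mul_inv, mul_comm, mul_assoc]
  congr 1
  field_simp
  ring

theorem qNum_sq {P : ℝ} (hP : 1 < P) (a : ℤ) :
    qNum (P ^ 4)⁻¹ a ^ 2 =
      ((1 - (P ^ 4)⁻¹) ^ 2)⁻¹ * ((P ^ 4)⁻¹) ^ a * brm P (2 * a.natAbs) ^ 2 := by
  have hP0 : P ≠ 0 := by linarith
  have hq : (P ^ 4)⁻¹ ≠ 0 := inv_ne_zero (pow_ne_zero _ hP0)
  have h1 : brm P (2 * a.natAbs) ^ 2 = sqSum (P ^ (2 * a.natAbs)) - 2 := by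
    have : P ^ (2 * a.natAbs) ≠ 0 := pow_ne_zero _ hP0
    simp only [brm, sqSum]
    field_simp
    ring
  rw [h1, sqSum_natAbs P, qNum]
  have h2 : ((P ^ 4)⁻¹) ^ a ≠ 0 := zpow_ne_zero _ hq
  generalize ((P ^ 4)⁻¹) ^ a = u at *
  rw [div_pow, div_eq_mul_inv, mul_comm, mul_assoc]
  congr 1
  field_simp
  ring

theorem rpow_half_natCast {P : ℝ} (hP : 1 < P) (N : ℕ) :
    ((P ^ 4)⁻¹) ^ ((N : ℝ) / 2) = (P ^ (2 * N))⁻¹ := by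
  have hP0 : 0 ≤ P := by linarith
  rw [Real.inv_rpow (by positivity), ← Real.rpow_natCast P 4, ← Real.rpow_mul hP0,
    ← Real.rpow_natCast P (2 * N)]
  congr 2
  push_cast; ring

/-- The weight of a single variable in the symmetric form of the `q`-sum. -/
def qWeight (P : ℝ) (n a : ℕ) : ℝ :=
  brm P (2 * a) ^ 2 * (P ^ (2 * a ^ 2))⁻¹ *
    (qfac (P ^ 4)⁻¹ (2 * n) / (qfac (P ^ 4)⁻¹ (n + a) * qfac (P ^ 4)⁻¹ (n - a)))

/-- The constant relating the `q`-sum to its symmetric form. -/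
def qConst (P : ℝ) (r : ℕ) : ℝ :=
  ∏ j ∈ range r, ((1 - (P ^ 4)⁻¹) ^ 2)⁻¹ ^ (j + 1) * (P ^ (2 * (j + 1) ^ 2))⁻¹

/-- This removes the asymmetry of the summand in the indices and in the signs of the `k_i`. -/
theorem q_summand_eq {P : ℝ} (hP : 1 < P) (r n : ℕ) (k : Fin r → ℤ) (hk : k ∈ box r n) :
    (∏ i : Fin r, ∏ j ∈ Ioi i, |qNum (P ^ 4)⁻¹ (k i - k j) * qNum (P ^ 4)⁻¹ (k i + k j)|) *
          ∏ i : Fin r,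
            qNum (P ^ 4)⁻¹ (k i) ^ 2 *
              ((P ^ 4)⁻¹) ^ (((k i : ℝ) - (r : ℝ) + (((i : ℕ) : ℝ) + 1) - 1) ^ 2 / 2) *
              qBinom (P ^ 4)⁻¹ (2 * (n : ℤ)) ((n : ℤ) + k i) =
    qConst P r * ((∏ i : Fin r, ∏ j ∈ Ioi i,
      |sqSum (P ^ (2 * (k i).natAbs)) - sqSum (P ^ (2 * (k j).natAbs))|) *
        ∏ i, qWeight P n (k i).natAbs) := by
  have hP4 : 1 < P ^ 4 := one_lt_pow₀ hP (by norm_num)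
  have hq0 : 0 < (P ^ 4)⁻¹ := by positivity
  have hq1 : (P ^ 4)⁻¹ < 1 := inv_lt_one_of_one_lt₀ hP4
  have hC : qConst P r = ∏ i : Fin r, ((1 - (P ^ 4)⁻¹) ^ 2)⁻¹ ^ (r - 1 - (i : ℕ) + 1) *
      (P ^ (2 * (r - 1 - (i : ℕ) + 1) ^ 2))⁻¹ := by
    rw [qConst, ← prod_range_reflect, prod_range]
  rw [hC, ← prod_mul_distrib, ← prod_mul_distrib, ← prod_mul_distrib]
  refine prod_congr rfl fun i _ => ?_
  simp only [abs_qNum_mul hP]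
  rw [prod_mul_distrib, prod_const, Fin.card_Ioi, qNum_sq hP,
    qBinom_central hq0 hq1 n (k i) (Fintype.mem_piFinset.1 hk i), qWeight]
  -- With `d = r - i` for the zero-based `i`, the `d - 1` Vandermonde factors and `[k_i]²`
  -- contribute `q^{d k_i}`, and `d k + (k - d)²/2 = k²/2 + d²/2`.
  have hexp : ((P ^ 4)⁻¹ ^ (k i)) ^ (r - 1 - (i : ℕ)) * (P ^ 4)⁻¹ ^ (k i) *
      ((P ^ 4)⁻¹) ^ (((k i : ℝ) - (r : ℝ) + (((i : ℕ) : ℝ) + 1) - 1) ^ 2 / 2) =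
      (P ^ (2 * (r - 1 - (i : ℕ) + 1) ^ 2))⁻¹ * (P ^ (2 * (k i).natAbs ^ 2))⁻¹ := by
    rw [← rpow_half_natCast hP, ← rpow_half_natCast hP, ← Real.rpow_intCast, ← Real.rpow_natCast,
      ← Real.rpow_mul hq0.le, ← Real.rpow_add hq0, ← Real.rpow_add hq0, ← Real.rpow_add hq0]
    congr 1
    have hi := i.2
    have h1 : ((r - 1 - (i : ℕ) : ℕ) : ℝ) = (r : ℝ) - 1 - (i : ℕ) := by
      rw [Nat.cast_sub (by omega), Nat.cast_sub (by omega)]; simp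
    have h2 : (((k i).natAbs : ℕ) : ℝ) ^ 2 = (k i : ℝ) ^ 2 := by
      rw [Nat.cast_natAbs]; simp
    push_cast
    rw [h1, h2]
    ring
  rw [mul_pow, pow_succ _ (r - 1 - (i : ℕ))]
  generalize ∏ j ∈ Ioi i, |sqSum (P ^ (2 * (k i).natAbs)) - sqSum (P ^ (2 * (k j).natAbs))| = G
  generalize ((P ^ 4)⁻¹) ^ (((k i : ℝ) - (r : ℝ) + (((i : ℕ) : ℝ) + 1) - 1) ^ 2 / 2) = E at *
  generalize ((1 - (P ^ 4)⁻¹) ^ 2)⁻¹ = c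
  generalize qfac _ _ / _ = B
  linear_combination (c ^ (r - 1 - (i : ℕ)) * G * c * brm P (2 * (k i).natAbs) ^ 2 * B) * hexp

/-! ### The one-variable weight as a reciprocal product of gaps -/

/-- `∏_{l=1}^k (P^{2l} - P^{-2l})`. -/
def bfac (P : ℝ) (k : ℕ) : ℝ := ∏ l ∈ range k, brm P (2 * (l + 1))

theorem bfac_succ (P : ℝ) (k : ℕ) : bfac P (k + 1) = bfac P k * brm P (2 * (k + 1)) :=
  prod_range_succ _ _

theorem bfac_eq {P : ℝ} (hP : 1 < P) (k : ℕ) :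
    bfac P k = P ^ (k * (k + 1)) * qfac (P ^ 4)⁻¹ k := by
  have hP0 : P ≠ 0 := by linarith
  induction k with
  | zero => simp [bfac, qfac]
  | succ k ih =>
    rw [bfac_succ, qfac_succ, ih,
      show (k + 1) * (k + 1 + 1) = k * (k + 1) + 2 * (k + 1) by ring, pow_add, brm]
    have : P ^ (2 * (k + 1)) - (P ^ (2 * (k + 1)))⁻¹ =
        P ^ (2 * (k + 1)) * (1 - ((P ^ 4)⁻¹) ^ (k + 1)) := by
      have : P ^ (2 * (k + 1)) ≠ 0 := pow_ne_zero _ hP0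
      have h2 : (P ^ 4) ^ (k + 1) = P ^ (2 * (k + 1)) * P ^ (2 * (k + 1)) := by
        rw [← pow_mul, ← pow_add]; congr 1; ring
      rw [inv_pow, h2]
      field_simp
    rw [this]; ring

theorem bfac_pos {P : ℝ} (hP : 1 < P) (k : ℕ) : 0 < bfac P k :=
  prod_pos fun _ _ => brm_pos hP (by omega)

theorem abs_sqSum_sub {P : ℝ} (hP : 1 < P) {a b : ℕ} (h : a ≤ b) :
    |sqSum (P ^ (2 * b)) - sqSum (P ^ (2 * a))| = brm P (2 * (b - a)) * brm P (2 * (b + a)) := by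
  rw [sqSum_pow_sub (by linarith) (by omega : 2 * a ≤ 2 * b), ← Nat.mul_sub, ← Nat.mul_add,
    abs_of_nonneg]
  have : ∀ k, 0 ≤ brm P k := fun k => by
    rcases Nat.eq_zero_or_pos k with rfl | hk
    · simp [brm]
    · exact (brm_pos hP hk.ne').le
  exact mul_nonneg (this _) (this _)

/-- By `abs_sqSum_sub` the gaps from `a + 1` supply brackets indexed by differences and sums. The
difference brackets and the sum brackets fill up two factorials except at twice and four times `a +
1`, which are the two extra factors. Here `c` is the distance from `a + 1` to the top of the
interval. -/
theorem prod_gap_mul {P : ℝ} (hP : 1 < P) (a c : ℕ) :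
    (∏ m ∈ (Icc 1 (a + 1 + c)).erase (a + 1),
      |sqSum (P ^ (2 * (a + 1))) - sqSum (P ^ (2 * m))|) *
      (brm P (2 * (a + 1)) * brm P (2 * (2 * (a + 1)))) =
      bfac P c * bfac P (a + 1 + (a + 1) + c) := by
  induction c with
  | zero =>
    have h1 : (Icc 1 (a + 1 + 0)).erase (a + 1) = (range a).image (· + 1) := by
      ext m
      simp only [mem_erase, mem_Icc, mem_image, mem_range]
      constructor
      · intro h; exact ⟨m - 1, by omega, by omega⟩
      · rintro ⟨l, h, rfl⟩; omega
    rw [h1, prod_image (by intro x _ y _ h; simpa using h)]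
    have h2 : ∏ m ∈ range a, |sqSum (P ^ (2 * (a + 1))) - sqSum (P ^ (2 * (m + 1)))| =
        (∏ m ∈ range a, brm P (2 * (a - m))) * ∏ m ∈ range a, brm P (2 * (a + 1 + m + 1)) := by
      rw [← prod_mul_distrib]
      refine prod_congr rfl fun m hm => ?_
      have := mem_range.1 hm
      rw [abs_sqSum_sub hP (by omega), show a + 1 - (m + 1) = a - m by omega]
      rfl
    have h3 : ∏ m ∈ range a, brm P (2 * (a - m)) = bfac P a := by
      rw [bfac, ← prod_range_reflect]
      refine prod_congr rfl fun m hm => ?_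
      have := mem_range.1 hm
      congr 2
      omega
    have h4 : bfac P (a + 1 + (a + 1)) = bfac P (a + 1) *
        ((∏ m ∈ range a, brm P (2 * (a + 1 + m + 1))) * brm P (2 * (a + 1 + a + 1))) := by
      rw [← prod_range_succ (fun m => brm P (2 * (a + 1 + m + 1))), bfac, prod_range_add]
      rfl
    rw [h2, h3, add_zero, h4, bfac_succ, show bfac P 0 = 1 from rfl,
      show 2 * (a + 1) = a + 1 + a + 1 by ring]
    ring
  | succ c ih =>
    have h1 : (Icc 1 (a + 1 + (c + 1))).erase (a + 1) =
        insert (a + 1 + (c + 1)) ((Icc 1 (a + 1 + c)).erase (a + 1)) := by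
      ext m
      simp only [mem_erase, mem_Icc, mem_insert]
      omega
    rw [h1, prod_insert (by simp), abs_sub_comm, abs_sqSum_sub hP (by omega), mul_assoc, ih,
      show a + 1 + (a + 1) + (c + 1) = a + 1 + (a + 1) + c + 1 by ring, bfac_succ, bfac_succ,
      show a + 1 + (c + 1) - (a + 1) = c + 1 by omega,
      show a + 1 + (c + 1) + (a + 1) = a + 1 + (a + 1) + c + 1 by ring]
    ring

theorem brm_two_mul (P : ℝ) (k : ℕ) : brm P (2 * k) = brm P k * brp P k := by
  simp only [brm, brp, two_mul, pow_add, mul_inv]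
  ring

/-- The square in `qWeight` supplies the missing brackets of `prod_gap_mul`, since `brm P (4a) = brm
P (2a) * brp P (2a)`; the two factorials then cancel the denominator of the `q`-binomial. -/
theorem qWeight_eq {P : ℝ} (hP : 1 < P) (n a : ℕ) (ha : a ∈ Icc 1 n) :
    qWeight P n a * (brp P (2 * a) * ∏ m ∈ (Icc 1 n).erase a,
      |sqSum (P ^ (2 * a)) - sqSum (P ^ (2 * m))|) =
      qfac (P ^ 4)⁻¹ (2 * n) * P ^ (2 * (n * (n + 1))) := by
  have hP4 : 1 < P ^ 4 := one_lt_pow₀ hP (by norm_num)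
  have hq0 : 0 < (P ^ 4)⁻¹ := by positivity
  have hq1 : (P ^ 4)⁻¹ < 1 := inv_lt_one_of_one_lt₀ hP4
  obtain ⟨h1, h2⟩ := mem_Icc.1 ha
  obtain ⟨a, rfl⟩ := Nat.exists_eq_add_of_le' h1
  obtain ⟨c, rfl⟩ := Nat.exists_eq_add_of_le h2
  have key := prod_gap_mul hP a c
  rw [brm_two_mul P (2 * (a + 1)), bfac_eq hP, bfac_eq hP] at key
  rw [qWeight, show a + 1 + c - (a + 1) = c by omega,
    show a + 1 + c + (a + 1) = a + 1 + (a + 1) + c by ring]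
  have e1 := (qfac_pos hq0 hq1 c).ne'
  have e2 := (qfac_pos hq0 hq1 (a + 1 + (a + 1) + c)).ne'
  have hpp : P ^ (2 * (a + 1) ^ 2) ≠ 0 := by positivity
  have hexp : P ^ (c * (c + 1)) * P ^ ((a + 1 + (a + 1) + c) * (a + 1 + (a + 1) + c + 1)) =
      P ^ (2 * (a + 1) ^ 2) * P ^ (2 * ((a + 1 + c) * (a + 1 + c + 1))) := by
    rw [← pow_add, ← pow_add]; congr 1; ring
  generalize ∏ m ∈ (Icc 1 (a + 1 + c)).erase (a + 1),
      |sqSum (P ^ (2 * (a + 1))) - sqSum (P ^ (2 * m))| = G at *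
  generalize P ^ (2 * ((a + 1 + c) * (a + 1 + c + 1))) = X1 at *
  generalize P ^ (2 * (a + 1) ^ 2) = X2 at *
  generalize P ^ (c * (c + 1)) = X3 at *
  generalize P ^ ((a + 1 + (a + 1) + c) * (a + 1 + (a + 1) + c + 1)) = X4 at *
  generalize qfac (P ^ 4)⁻¹ (2 * (a + 1 + c)) = Q0
  generalize qfac (P ^ 4)⁻¹ c = Q1 at *
  generalize qfac (P ^ 4)⁻¹ (a + 1 + (a + 1) + c) = Q2 at *
  field_simp
  linear_combination Q0 * key + Q0 * Q1 * Q2 * hexp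

/-! ### The dual sum -/

/-- The sum over `m`-subsets of `{1, …, n}` dual to the `q`-sum. -/
def dualSum (P : ℝ) (n m : ℕ) : ℝ :=
  ∑ B ∈ (Icc 1 n).powersetCard m,
    (∏ b ∈ B, brp P (2 * b)) * gapProd (fun a => sqSum (P ^ (2 * a))) B

/-- The summand of `dualSum` for the full set `{1, …, n}`. -/
def dualFull (P : ℝ) (n : ℕ) : ℝ :=
  (∏ b ∈ Icc 1 n, brp P (2 * b)) * gapProd (fun a => sqSum (P ^ (2 * a))) (Icc 1 n)

theorem dualFull_pos {P : ℝ} (hP : 1 < P) (n : ℕ) : 0 < dualFull P n :=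
  mul_pos (prod_pos fun _ _ => brp_pos hP _) (gapProd_pos (sqSum_pow_strictMono hP).injective _)

theorem dualSum_self (P : ℝ) (n : ℕ) : dualSum P n n = dualFull P n := by
  have : (Icc 1 n).powersetCard n = {Icc 1 n} := by
    simpa using powersetCard_self (Icc 1 n)
  rw [dualSum, this, sum_singleton, dualFull]

theorem dualFull_succ {P : ℝ} (hP : 1 < P) (n : ℕ) :
    dualFull P (n + 1) * brm P (2 * (n + 1)) ^ 2 = dualFull P n * bfac P (2 * n + 2) := by
  have h := prod_gap_mul hP n 0
  have he : (Icc 1 (n + 1)).erase (n + 1) = Icc 1 n := by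
    ext m; simp only [mem_erase, mem_Icc]; omega
  have hi : Icc 1 (n + 1) = insert (n + 1) (Icc 1 n) := by
    ext m; simp only [mem_insert, mem_Icc]; omega
  rw [add_zero, he, brm_two_mul P (2 * (n + 1)), show bfac P 0 = 1 from rfl, one_mul,
    show n + 1 + (n + 1) + 0 = 2 * n + 2 by ring] at h
  rw [dualFull, hi, prod_insert (by simp), gapProd_insert _ (by simp), dualFull, ← h]
  ring

theorem q_sum_eq {P : ℝ} (hP : 1 < P) (m r : ℕ) :
    (∑ k ∈ box r (m + r),
      (∏ i : Fin r, ∏ j ∈ Ioi i, |qNum (P ^ 4)⁻¹ (k i - k j) * qNum (P ^ 4)⁻¹ (k i + k j)|) *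
          ∏ i : Fin r,
            qNum (P ^ 4)⁻¹ (k i) ^ 2 *
              ((P ^ 4)⁻¹) ^ (((k i : ℝ) - (r : ℝ) + (((i : ℕ) : ℝ) + 1) - 1) ^ 2 / 2) *
              qBinom (P ^ 4)⁻¹ (2 * ((m + r : ℕ) : ℤ)) (((m + r : ℕ) : ℤ) + k i)) =
      qConst P r * 2 ^ r * r.factorial *
        (qfac (P ^ 4)⁻¹ (2 * (m + r)) * P ^ (2 * ((m + r) * (m + r + 1)))) ^ r *
        (dualSum P (m + r) m / dualFull P (m + r)) := by
  rw [sum_congr rfl fun k hk => q_summand_eq hP r (m + r) k hk, ← mul_sum,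
    sum_box_natAbs r (m + r) (fun a : Fin r → ℕ => (∏ i : Fin r, ∏ j ∈ Ioi i,
      |sqSum (P ^ (2 * a i)) - sqSum (P ^ (2 * a j))|) * ∏ i, qWeight P (m + r) (a i)),
    sum_piFinset_gapProd (fun a => sqSum (P ^ (2 * a))) (qWeight P (m + r))]
  · set n := m + r with hn
    set x : ℕ → ℝ := fun a => sqSum (P ^ (2 * a)) with hx
    have hxi : Function.Injective x := (sqSum_pow_strictMono hP).injective
    have hA : ∀ A ∈ (Icc 1 n).powersetCard r, gapProd x A * ∏ a ∈ A, qWeight P n a =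
        (qfac (P ^ 4)⁻¹ (2 * n) * P ^ (2 * (n * (n + 1)))) ^ r / dualFull P n *
        ((∏ b ∈ Icc 1 n \ A, brp P (2 * b)) * gapProd x (Icc 1 n \ A)) := by
      intro A hA
      obtain ⟨h1, h2⟩ := mem_powersetCard.1 hA
      have e1 := gapProd_compl x (Icc 1 n) A h1
      have e2 : (∏ a ∈ A, qWeight P n a) * ((∏ a ∈ A, brp P (2 * a)) *
          ∏ a ∈ A, ∏ m ∈ (Icc 1 n).erase a, |x a - x m|) =
          (qfac (P ^ 4)⁻¹ (2 * n) * P ^ (2 * (n * (n + 1)))) ^ r := by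
        rw [← prod_mul_distrib, ← prod_mul_distrib, ← h2, ← prod_const]
        exact prod_congr rfl fun a ha => qWeight_eq hP n a (h1 ha)
      have e3 : (∏ b ∈ Icc 1 n \ A, brp P (2 * b)) * ∏ b ∈ A, brp P (2 * b) =
          ∏ b ∈ Icc 1 n, brp P (2 * b) := prod_sdiff h1
      have hX : (∏ a ∈ A, ∏ m ∈ (Icc 1 n).erase a, |x a - x m|) ≠ 0 :=
        prod_ne_zero_iff.2 fun a _ => prod_ne_zero_iff.2 fun b hb =>
          abs_ne_zero.2 (sub_ne_zero.2 fun h => (mem_erase.1 hb).1 (hxi h).symm)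
      have hB : (∏ b ∈ A, brp P (2 * b)) ≠ 0 := prod_ne_zero_iff.2 fun b _ => (brp_pos hP _).ne'
      have hB' : (∏ b ∈ Icc 1 n \ A, brp P (2 * b)) ≠ 0 :=
        prod_ne_zero_iff.2 fun b _ => (brp_pos hP _).ne'
      have hU := (gapProd_pos hxi (Icc 1 n)).ne'
      rw [dualFull, ← e2, ← e3]
      change _ = _ / (_ * gapProd x (Icc 1 n)) * _
      field_simp
      linear_combination (∏ a ∈ A, qWeight P n a) * e1
    rw [sum_congr rfl hA, ← mul_sum,
      sum_powersetCard_compl (Icc 1 n) m r (by simp [hn]) (fun B =>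
        (∏ b ∈ B, brp P (2 * b)) * gapProd x B), dualSum]
    ring
  · intro a i hi
    have : ∏ i, qWeight P (m + r) (a i) = 0 :=
      prod_eq_zero (mem_univ i) (by simp [qWeight, hi, brm])
    rw [this, mul_zero]

/-! ### Product formula for the dual sum and its recurrence in `r` -/

/-- The Vandermonde product of the numbers `P^{2e} + P^{-2e}`, `e = r+1, r+3, …, r+2m-1`. -/
def stepVdm (P : ℝ) (m r : ℕ) : ℝ :=
  ∏ j ∈ range m, ∏ i ∈ range j, (sqSum (P ^ (r + 1 + 2 * j)) - sqSum (P ^ (r + 1 + 2 * i)))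

theorem stepVdm_succ {P : ℝ} (hP : 1 < P) (m r : ℕ) :
    stepVdm P (m + 1) r * bfac P (r + m) = stepVdm P m r * (bfac P m * bfac P (r + 2 * m)) := by
  have h1 : ∏ i ∈ range m, (sqSum (P ^ (r + 1 + 2 * m)) - sqSum (P ^ (r + 1 + 2 * i))) =
      (∏ i ∈ range m, brm P (2 * (m - i))) * ∏ i ∈ range m, brm P (2 * (r + m + i + 1)) := by
    rw [← prod_mul_distrib]
    refine prod_congr rfl fun i hi => ?_
    have := mem_range.1 hi
    rw [sqSum_pow_sub (by linarith) (by omega)]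
    congr 2 <;> omega
  have h2 : ∏ i ∈ range m, brm P (2 * (m - i)) = bfac P m := by
    rw [bfac, ← prod_range_reflect]
    refine prod_congr rfl fun i hi => ?_
    have := mem_range.1 hi
    congr 2
    omega
  have h3 : bfac P (r + 2 * m) = bfac P (r + m) * ∏ i ∈ range m, brm P (2 * (r + m + i + 1)) := by
    rw [show r + 2 * m = r + m + m by ring, bfac, prod_range_add]; rfl
  rw [stepVdm, prod_range_succ, h1, h2, h3, stepVdm]
  ring

theorem stepVdm_pos {P : ℝ} (hP : 1 < P) (m r : ℕ) : 0 < stepVdm P m r :=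
  prod_pos fun j _ => prod_pos fun i hi => by
    have := mem_range.1 hi
    rw [sqSum_pow_sub (by linarith) (by omega)]
    exact mul_pos (brm_pos hP (by omega)) (brm_pos hP (by omega))

/-- Induction on `m` through `stepVdm_succ`. The shift is by two because in the ratio of consecutive
dual sums the Vandermonde product with parameter `r + 1` cancels. -/
theorem stepVdm_add_two {P : ℝ} (hP : 1 < P) (m r : ℕ) :
    stepVdm P m (r + 2) * (∏ i ∈ range m, brm P (2 * (r + 2 + 2 * i)) * brm P (2 * (r + 3 + 2 * i)))
      * (bfac P (r + m) * bfac P (r + m + 1)) =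
    stepVdm P m r * (bfac P (r + 2 * m) * bfac P (r + 2 * m + 1)) := by
  induction m with
  | zero => simp [stepVdm]
  | succ m ih =>
    have h1 := stepVdm_succ hP m (r + 2)
    have h2 := stepVdm_succ hP m r
    have b0 : ∀ k, bfac P k ≠ 0 := fun k => (bfac_pos hP k).ne'
    rw [show r + 2 + m = r + (m + 1) + 1 by ring,
      show r + 2 + 2 * m = r + 2 * (m + 1) by ring] at h1
    have h3 : bfac P (r + 2 * (m + 1) + 1) =
        bfac P (r + 2 * m + 1) * brm P (2 * (r + 2 + 2 * m)) * brm P (2 * (r + 3 + 2 * m)) := by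
      rw [show r + 2 * (m + 1) + 1 = r + 2 * m + 1 + 1 + 1 by ring, bfac_succ, bfac_succ]
      congr 3 <;> ring
    rw [prod_range_succ, h3]
    rw [show r + (m + 1) = r + m + 1 by ring] at *
    refine mul_right_cancel₀ (b0 (r + m)) ?_
    generalize brm P (2 * (r + 2 + 2 * m)) = u at *
    generalize brm P (2 * (r + 3 + 2 * m)) = v at *
    generalize (∏ i ∈ range m, brm P (2 * (r + 2 + 2 * i)) * brm P (2 * (r + 3 + 2 * i))) = Q at *
    generalize bfac P (r + 2 * (m + 1)) = w at *
    linear_combination (Q * u * v * bfac P (r + m + 1) * bfac P (r + m)) * h1 +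
      (bfac P m * w * u * v) * ih - (w * bfac P (r + 2 * m + 1) * u * v) * h2

theorem dualSum_mul {P : ℝ} (hP : 1 < P) (m r : ℕ) :
    dualSum P (m + r) m * ((∏ i : Fin m, brm P (2 * i + 1)) *
      (vdm fun i : Fin m => sqSum (P ^ (2 * (i : ℕ) + 1)))) =
    (∏ j ∈ range m, brm P (r + 1 + 2 * j)) * stepVdm P m r *
      ((∏ j ∈ range m, brp P (r + 2 + 2 * j)) * stepVdm P m (r + 1)) := by
  have h := chainSum_odd_powers hP m r
  rw [← sum_powersetCard_gapProd hP, vdm_eq_prod_range m (fun j => sqSum (P ^ (r + 1 + 2 * j))),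
    vdm_eq_prod_range m (fun j => sqSum (P ^ (r + 2 + 2 * j)))] at h
  rw [dualSum, ← mul_assoc, h, prod_range (fun j => brm P (r + 1 + 2 * j)),
    prod_range (fun j => brp P (r + 2 + 2 * j))]
  rfl

/-- The normalizing factor in `dualSum_mul` depends on `m` only, so it drops out when `r` and `r +
1` are compared. -/
theorem dualSum_ratio {P : ℝ} (hP : 1 < P) (m r : ℕ) :
    dualSum P (m + r + 1) m * (∏ j ∈ range m, brm P (r + 1 + 2 * j) * brm P (r + 3 + 2 * j) *
        brp P (r + 2 + 2 * j) ^ 2) * (bfac P (m + r) * bfac P (m + r + 1)) =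
      dualSum P (m + r) m * (bfac P (r + 2 * m) * bfac P (r + 2 * m + 1)) := by
  have h1 := dualSum_mul hP m r
  have h2 := dualSum_mul hP m (r + 1)
  have h3 := stepVdm_add_two hP m r
  set N := ((∏ i : Fin m, brm P (2 * i + 1)) *
      (vdm fun i : Fin m => sqSum (P ^ (2 * (i : ℕ) + 1)))) with hN
  have hN0 : N ≠ 0 := by
    refine mul_ne_zero (prod_ne_zero_iff.2 fun i _ => (brm_pos hP (by omega)).ne') ?_
    rw [vdm_eq_prod_range m (fun i => sqSum (P ^ (2 * i + 1)))]
    refine prod_ne_zero_iff.2 fun j _ => prod_ne_zero_iff.2 fun i hi => ?_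
    have := mem_range.1 hi
    rw [sqSum_pow_sub (by linarith) (by omega)]
    exact (mul_pos (brm_pos hP (by omega)) (brm_pos hP (by omega))).ne'
  simp only [brm_two_mul, prod_mul_distrib] at h3
  rw [show m + r = r + m by ring] at *
  rw [show m + (r + 1) = r + m + 1 by ring, show r + 1 + 1 = r + 2 by ring] at h2
  rw [show r + 1 + 2 = r + 3 by ring] at h2
  simp only [prod_mul_distrib, prod_pow]
  have hv := (stepVdm_pos hP m r).ne'
  have hm2 : (∏ j ∈ range m, brm P (r + 2 + 2 * j)) ≠ 0 :=
    prod_ne_zero_iff.2 fun i _ => (brm_pos hP (by omega)).ne'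
  have hp3 : (∏ j ∈ range m, brp P (r + 3 + 2 * j)) ≠ 0 :=
    prod_ne_zero_iff.2 fun i _ => (brp_pos hP _).ne'
  refine mul_right_cancel₀ (mul_ne_zero hN0 hv) ?_
  generalize (∏ j ∈ range m, brm P (r + 1 + 2 * j)) = a1 at *
  generalize (∏ j ∈ range m, brm P (r + 2 + 2 * j)) = a2 at *
  generalize (∏ j ∈ range m, brm P (r + 3 + 2 * j)) = a3 at *
  generalize (∏ j ∈ range m, brp P (r + 2 + 2 * j)) = b2 at *
  generalize (∏ j ∈ range m, brp P (r + 3 + 2 * j)) = b3 at *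
  generalize stepVdm P m r = v0 at *
  generalize stepVdm P m (r + 1) = v1 at *
  generalize stepVdm P m (r + 2) = v2 at *
  generalize dualSum P (r + m) m = s0 at *
  generalize dualSum P (r + m + 1) m = s1 at *
  generalize bfac P (r + m) = f0 at *
  generalize bfac P (r + m + 1) = f1 at *
  generalize bfac P (r + 2 * m) = g0 at *
  generalize bfac P (r + 2 * m + 1) = g1 at *
  linear_combination (a1 * a3 * b2 ^ 2 * f0 * f1 * v0) * h2 + (a1 * b2 * v0 * v1) * h3 -
    (g0 * g1 * v0) * h1

/-- The value of the `q`-sum in terms of the dual sum. -/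
def qSumValue (P : ℝ) (m r : ℕ) : ℝ :=
  qConst P r * 2 ^ r * r.factorial *
    (qfac (P ^ 4)⁻¹ (2 * (m + r)) * P ^ (2 * ((m + r) * (m + r + 1)))) ^ r *
    (dualSum P (m + r) m / dualFull P (m + r))

theorem qSumValue_zero {P : ℝ} (hP : 1 < P) (m : ℕ) : qSumValue P m 0 = 1 := by
  simp [qSumValue, qConst, dualSum_self, (dualFull_pos hP m).ne']

theorem brm_eq {P : ℝ} (hP : 1 < P) (k : ℕ) : brm P k = P ^ k * (1 - ((P ^ 2)⁻¹) ^ k) := by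
  have : P ^ k ≠ 0 := pow_ne_zero _ (by linarith)
  rw [brm, inv_pow, ← pow_mul, mul_comm 2 k, pow_mul]
  field_simp

theorem brp_eq {P : ℝ} (hP : 1 < P) (k : ℕ) : brp P k = P ^ k * (1 + ((P ^ 2)⁻¹) ^ k) := by
  have : P ^ k ≠ 0 := pow_ne_zero _ (by linarith)
  rw [brp, inv_pow, ← pow_mul, mul_comm 2 k, pow_mul]
  field_simp

theorem prod_brm_brp {P : ℝ} (hP : 1 < P) (m r : ℕ) :
    (∏ j ∈ range m, brm P (r + 1 + 2 * j) * brm P (r + 3 + 2 * j) * brp P (r + 2 + 2 * j) ^ 2) =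
      P ^ (4 * m * (m + r + 1)) * ((∏ j ∈ range m, (1 - ((P ^ 2)⁻¹) ^ (r + 1 + 2 * j))) *
        (∏ j ∈ range m, (1 - ((P ^ 2)⁻¹) ^ (r + 3 + 2 * j))) *
        (∏ j ∈ range m, (1 + ((P ^ 2)⁻¹) ^ (r + 2 + 2 * j))) ^ 2) := by
  have h : P ^ (4 * m * (m + r + 1)) = ∏ j ∈ range m, P ^ (4 * (r + 2 + 2 * j)) := by
    induction m with
    | zero => simp
    | succ m ih =>
      rw [prod_range_succ, ← ih, ← pow_add]
      congr 1
      ring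
  rw [h, ← prod_pow, ← prod_mul_distrib, ← prod_mul_distrib, ← prod_mul_distrib]
  refine prod_congr rfl fun j _ => ?_
  rw [brm_eq hP, brm_eq hP, brp_eq hP,
    show 4 * (r + 2 + 2 * j) = r + 1 + 2 * j + (r + 3 + 2 * j) + ((r + 2 + 2 * j) + (r + 2 + 2 * j))
      by ring, pow_add P (_ + _) (_ + _ + (_ + _)), pow_add P (r + 1 + 2 * j),
    pow_add P (r + 2 + 2 * j)]
  ring

/-- All explicit powers of `P` cancel, leaving factors in `q = P⁻⁴` and `q^{1/2} = P⁻²` that can be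
matched with the closed form. -/
theorem qSumValue_succ {P : ℝ} (hP : 1 < P) (m r : ℕ) :
    qSumValue P m (r + 1) * (((1 - (P ^ 4)⁻¹) ^ 2) ^ (r + 1) * qfac (P ^ 4)⁻¹ (2 * (m + r)) ^ r *
      qfac (P ^ 4)⁻¹ (m + r) ^ 3 * ((∏ j ∈ range m, (1 - ((P ^ 2)⁻¹) ^ (r + 1 + 2 * j))) *
        (∏ j ∈ range m, (1 - ((P ^ 2)⁻¹) ^ (r + 3 + 2 * j))) *
        (∏ j ∈ range m, (1 + ((P ^ 2)⁻¹) ^ (r + 2 + 2 * j))) ^ 2)) =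
    qSumValue P m r * (2 * (r + 1) * qfac (P ^ 4)⁻¹ (2 * (m + r + 1)) ^ r *
      qfac (P ^ 4)⁻¹ (m + r + 1) * qfac (P ^ 4)⁻¹ (r + 2 * m) *
      qfac (P ^ 4)⁻¹ (r + 2 * m + 1)) := by
  have hP4 : 1 < P ^ 4 := one_lt_pow₀ hP (by norm_num)
  have hq0 : 0 < (P ^ 4)⁻¹ := by positivity
  have hq1 : (P ^ 4)⁻¹ < 1 := inv_lt_one_of_one_lt₀ hP4
  have hs0 : 0 < (P ^ 2)⁻¹ := by positivity
  have hs1 : (P ^ 2)⁻¹ < 1 := inv_lt_one_of_one_lt₀ (one_lt_pow₀ hP (by norm_num))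
  have hF : ∀ k, qfac (P ^ 4)⁻¹ k ≠ 0 := fun k => (qfac_pos hq0 hq1 k).ne'
  have hpw : ∀ k, P ^ k ≠ 0 := fun k => pow_ne_zero _ (by linarith)
  have hA : (∏ j ∈ range m, (1 - ((P ^ 2)⁻¹) ^ (r + 1 + 2 * j))) *
        (∏ j ∈ range m, (1 - ((P ^ 2)⁻¹) ^ (r + 3 + 2 * j))) *
        (∏ j ∈ range m, (1 + ((P ^ 2)⁻¹) ^ (r + 2 + 2 * j))) ^ 2 ≠ 0 := by
    have h1 : ∀ k, k ≠ 0 → 1 - ((P ^ 2)⁻¹) ^ k ≠ 0 := fun k hk =>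
      (sub_pos.2 (pow_lt_one₀ hs0.le hs1 hk)).ne'
    refine mul_ne_zero (mul_ne_zero (prod_ne_zero_iff.2 fun j _ => h1 _ (by omega))
      (prod_ne_zero_iff.2 fun j _ => h1 _ (by omega))) (pow_ne_zero _
      (prod_ne_zero_iff.2 fun j _ => by positivity))
  have h1 := dualSum_ratio hP m r
  rw [prod_brm_brp hP, bfac_eq hP (m + r), bfac_eq hP (m + r + 1), bfac_eq hP (r + 2 * m),
    bfac_eq hP (r + 2 * m + 1)] at h1
  have h2 := dualFull_succ hP (m + r)
  rw [bfac_eq hP (2 * (m + r) + 2), show 2 * (m + r) + 2 = 2 * (m + r + 1) by ring] at h2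
  have h3 := bfac_succ P (m + r)
  rw [bfac_eq hP (m + r), bfac_eq hP (m + r + 1)] at h3
  have hexp : (P ^ (2 * ((m + r + 1) * (m + r + 1 + 1)))) ^ (r + 1) *
      (P ^ ((m + r + 1) * (m + r + 1 + 1)) * P ^ ((r + 2 * m) * (r + 2 * m + 1)) *
        P ^ ((r + 2 * m + 1) * (r + 2 * m + 1 + 1))) =
      (P ^ (2 * ((m + r) * (m + r + 1)))) ^ r * P ^ (2 * (r + 1) ^ 2) *
      (P ^ ((m + r) * (m + r + 1))) ^ 3 * P ^ (2 * (m + r + 1) * (2 * (m + r + 1) + 1)) *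
      P ^ (4 * m * (m + r + 1)) := by
    simp only [← pow_mul, ← pow_add]
    congr 1
    ring
  have hC : qConst P (r + 1) = qConst P r *
      (((1 - (P ^ 4)⁻¹) ^ 2)⁻¹ ^ (r + 1) * (P ^ (2 * (r + 1) ^ 2))⁻¹) := prod_range_succ _ _
  have hc : (1 - (P ^ 4)⁻¹) ^ 2 ≠ 0 := pow_ne_zero _ (by linarith)
  have hW0 := (dualFull_pos hP (m + r)).ne'
  have hW1 := (dualFull_pos hP (m + r + 1)).ne'
  have hb : brm P (2 * (m + r + 1)) ≠ 0 := (brm_pos hP (by omega)).ne'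
  rw [qSumValue, qSumValue, hC, ← add_assoc m r 1, Nat.factorial_succ, inv_pow, mul_pow, mul_pow]
  have p1 := hpw ((m + r + 1) * (m + r + 1 + 1))
  have p2 := hpw ((r + 2 * m) * (r + 2 * m + 1))
  have p3 := hpw ((r + 2 * m + 1) * (r + 2 * m + 1 + 1))
  have p4 := hpw (2 * (r + 1) ^ 2)
  have p5 := hpw ((m + r) * (m + r + 1))
  have p6 := hpw (2 * (m + r + 1) * (2 * (m + r + 1) + 1))
  have p7 := hpw (4 * m * (m + r + 1))
  have hF0 := hF (m + r)
  have hF1 := hF (m + r + 1)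
  have hQ2 := hF (2 * (m + r + 1))
  have hcr := pow_ne_zero (r + 1) hc
  push_cast
  rw [pow_succ (qfac (P ^ 4)⁻¹ (2 * (m + r + 1)))]
  clear hC hP4 hq0 hq1 hs0 hs1 hpw
  -- Only the relations `h1`, `h2`, `h3` and `hexp` between these quantities matter; with letters in
  -- their place the claim is an identity of rational functions.
  generalize (∏ j ∈ range m, (1 - ((P ^ 2)⁻¹) ^ (r + 1 + 2 * j))) *
        (∏ j ∈ range m, (1 - ((P ^ 2)⁻¹) ^ (r + 3 + 2 * j))) *
        (∏ j ∈ range m, (1 + ((P ^ 2)⁻¹) ^ (r + 2 + 2 * j))) ^ 2 = A at *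
  generalize (P ^ (2 * ((m + r + 1) * (m + r + 1 + 1)))) ^ (r + 1) = y2 at *
  generalize (P ^ (2 * ((m + r) * (m + r + 1)))) ^ r = y0 at *
  generalize P ^ ((m + r + 1) * (m + r + 1 + 1)) = x1 at *
  generalize P ^ ((r + 2 * m) * (r + 2 * m + 1)) = g0 at *
  generalize P ^ ((r + 2 * m + 1) * (r + 2 * m + 1 + 1)) = g1 at *
  generalize P ^ (2 * (r + 1) ^ 2) = p at *
  generalize P ^ ((m + r) * (m + r + 1)) = x0 at *
  generalize P ^ (2 * (m + r + 1) * (2 * (m + r + 1) + 1)) = xw at *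
  generalize P ^ (4 * m * (m + r + 1)) = Z at *
  generalize ((1 - (P ^ 4)⁻¹) ^ 2) ^ (r + 1) = c at *
  generalize brm P (2 * (m + r + 1)) = b at *
  generalize dualSum P (m + r + 1) m = D1 at *
  generalize dualSum P (m + r) m = D0 at *
  generalize dualFull P (m + r + 1) = W1 at *
  generalize dualFull P (m + r) = W0 at *
  generalize qfac (P ^ 4)⁻¹ (2 * (m + r + 1)) ^ r = Q2r at *
  generalize qfac (P ^ 4)⁻¹ (2 * (m + r + 1)) = Q2 at *
  generalize qfac (P ^ 4)⁻¹ (2 * (m + r)) ^ r = Q0r at *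
  generalize qfac (P ^ 4)⁻¹ (m + r + 1) = F1 at *
  generalize qfac (P ^ 4)⁻¹ (m + r) = F0 at *
  generalize qfac (P ^ 4)⁻¹ (r + 2 * m + 1) = G1 at *
  generalize qfac (P ^ 4)⁻¹ (r + 2 * m) = G0 at *
  have e1 : D1 = D0 * (g0 * G0 * (g1 * G1)) / (Z * A * (x0 * F0 * (x1 * F1))) := by
    rw [eq_div_iff (by positivity)]; linear_combination h1
  have e3 : b = x1 * F1 / (x0 * F0) := by
    rw [eq_div_iff (by positivity)]; linear_combination -h3
  have e2 : W1 = W0 * (xw * Q2) / b ^ 2 := by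
    rw [eq_div_iff (by positivity)]; linear_combination h2
  have hg0 : g0 ≠ 0 := p2
  have e4 : y2 = y0 * p * x0 ^ 3 * xw * Z / (x1 * g0 * g1) := by
    rw [eq_div_iff (by positivity)]; linear_combination hexp
  clear h1 h2 h3 hexp
  rw [e1, e2, e3, e4]
  field_simp
  ring

/-! ### Gamma functions at half-integers -/

/-- `(-s;s)_j`. -/
def sfac (s : ℝ) (j : ℕ) : ℝ := ∏ l ∈ range j, (1 + s ^ (l + 1))

theorem sfac_succ (s : ℝ) (j : ℕ) : sfac s (j + 1) = sfac s j * (1 + s ^ (j + 1)) :=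
  prod_range_succ _ _

theorem sfac_pos {s : ℝ} (hs : 0 < s) (j : ℕ) : 0 < sfac s j :=
  prod_pos fun _ _ => by positivity

theorem qPoch_neg_self (s : ℝ) (n : ℕ) : qPoch (-s) s n = sfac s n := by
  rw [qPoch_natCast, sfac]
  exact prod_congr rfl fun _ _ => by ring

theorem qfac_sq (s : ℝ) (j : ℕ) : qfac (s ^ 2) j = qfac s j * sfac s j := by
  rw [qfac, qfac, sfac, ← prod_mul_distrib]
  refine prod_congr rfl fun l _ => ?_
  rw [← pow_mul, mul_comm 2, pow_mul]
  ring

/-- Values `g k = Γ(1 + k/2)`, `h = Γ(1/2)` of a function with `Γ(x + 1) = N(x) Γ(x)`,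
where `N k` stands for `N(k/2)`. -/
structure IsHalfGamma (N g : ℕ → ℝ) (h : ℝ) : Prop where
  h_ne : h ≠ 0
  zero : g 0 = 1
  one : g 1 = N 1 * h
  add_two : ∀ k, g (k + 2) = N (k + 2) * g k
  N_ne : ∀ k, k ≠ 0 → N k ≠ 0

namespace IsHalfGamma

variable {N g : ℕ → ℝ} {h : ℝ}

theorem ne_zero (H : IsHalfGamma N g h) : ∀ k, g k ≠ 0
  | 0 => by rw [H.zero]; exact one_ne_zero
  | 1 => by rw [H.one]; exact mul_ne_zero (H.N_ne 1 one_ne_zero) H.h_ne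
  | k + 2 => by rw [H.add_two]; exact mul_ne_zero (H.N_ne _ (by omega)) (H.ne_zero k)

theorem add_two_mul (H : IsHalfGamma N g h) (k d : ℕ) :
    g (k + 2 * d) = g k * ∏ l ∈ range d, N (k + 2 * l + 2) := by
  induction d with
  | zero => simp
  | succ d ih =>
    rw [prod_range_succ, show k + 2 * (d + 1) = k + 2 * d + 2 by ring, H.add_two, ih]
    ring

theorem odd (H : IsHalfGamma N g h) (d : ℕ) :
    g (2 * d + 1) = h * ∏ l ∈ range (d + 1), N (2 * l + 1) := by
  rw [add_comm, H.add_two_mul, H.one, prod_range_succ']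
  have : ∀ l, 1 + 2 * l + 2 = 2 * (l + 1) + 1 := fun l => by ring
  simp only [this]
  ring

end IsHalfGamma

/-- The `i`-th factor of the product of Gamma functions. -/
def gammaFactor (g : ℕ → ℝ) (h : ℝ) (n i : ℕ) : ℝ :=
  g i ^ 2 / h * (g (4 * n) * g (2 * (n - i) + 1) / (g (2 * (n - i)) * g (2 * n - i) ^ 2))

/-- The `i`-th factor of the product of Gamma functions as a finite product. -/
def gammaFinite (N : ℕ → ℝ) (n i : ℕ) : ℝ :=
  (∏ l ∈ range (n - i + 1), N (2 * l + 1)) *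
    (∏ l ∈ range (n + i), N (2 * (n - i) + 2 * l + 2)) /
    (∏ l ∈ range (n - i), N (i + 2 * l + 2)) ^ 2

/-- The arguments pair up with integer differences, and `h` cancels against the value at the odd
index. Hence the factor depends on `N` alone, which is what allows passage to the limit. -/
theorem gammaFactor_eq_finite {N g : ℕ → ℝ} {h : ℝ} (H : IsHalfGamma N g h) {n i : ℕ}
    (hi : i ≤ n) : gammaFactor g h n i = gammaFinite N n i := by
  have h1 := H.add_two_mul i (n - i)
  rw [show i + 2 * (n - i) = 2 * n - i by omega] at h1
  have h2 := H.add_two_mul (2 * (n - i)) (n + i)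
  rw [show 2 * (n - i) + 2 * (n + i) = 4 * n by omega] at h2
  rw [gammaFactor, gammaFinite, h1, h2, H.odd]
  have e1 := H.ne_zero i
  have e2 := H.ne_zero (2 * (n - i))
  have e3 := H.h_ne
  have e4 : ∏ l ∈ range (n - i), N (i + 2 * l + 2) ≠ 0 :=
    prod_ne_zero_iff.2 fun l _ => H.N_ne _ (by omega)
  field_simp

theorem prod_gammaFactor (g : ℕ → ℝ) (h : ℝ) (m r : ℕ) :
    ∏ i ∈ Icc 1 r, gammaFactor g h (m + r) i =
      (∏ l ∈ range r, g (l + 1) ^ 2 / h) * g (4 * (m + r)) ^ r *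
        (∏ l ∈ range r, g (2 * (m + l) + 1) / g (2 * (m + l))) /
        (∏ l ∈ range r, g (2 * m + r + l)) ^ 2 := by
  have h1 : ∀ f : ℕ → ℝ, ∏ i ∈ Icc 1 r, f i = ∏ l ∈ range r, f (l + 1) := fun f => by
    rw [range_eq_Ico, prod_Ico_add']
    rfl
  have h2 : ∏ l ∈ range r, g (2 * (m + l) + 1) / g (2 * (m + l)) =
      ∏ l ∈ range r, g (2 * (m + r - (l + 1)) + 1) / g (2 * (m + r - (l + 1))) := by
    rw [← prod_range_reflect]
    refine prod_congr rfl fun l hl => ?_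
    have := mem_range.1 hl
    rw [show m + (r - 1 - l) = m + r - (l + 1) by omega]
  have h3 : ∏ l ∈ range r, g (2 * m + r + l) =
      ∏ l ∈ range r, g (2 * (m + r) - (l + 1)) := by
    rw [← prod_range_reflect]
    refine prod_congr rfl fun l hl => ?_
    have := mem_range.1 hl
    congr 1
    omega
  rw [h1, h2, h3, ← prod_pow, ← Fin.prod_const r, ← prod_range (fun _ => g (4 * (m + r))),
    ← prod_mul_distrib, ← prod_mul_distrib, ← prod_div_distrib]
  refine prod_congr rfl fun l _ => ?_
  rw [gammaFactor]
  ring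

section QuantumGamma

variable {s : ℝ} {g : ℕ → ℝ} {h : ℝ}

/-- The `q`-analogue of Legendre's duplication formula. -/
theorem halfGamma_mul (H : IsHalfGamma (fun k => (1 - s ^ k) / (1 - s ^ 2)) g h) (k : ℕ) :
    g k * g (k + 1) = qfac s (k + 1) / (1 - s ^ 2) ^ (k + 1) * h := by
  induction k with
  | zero => rw [H.zero, H.one]; simp [qfac]
  | succ k ih =>
    rw [H.add_two, mul_left_comm, mul_comm (g (k + 1)), ih, qfac_succ s (k + 1),
      pow_succ _ (k + 1)]
    generalize 1 - s ^ 2 = c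
    ring

theorem halfGamma_even (H : IsHalfGamma (fun k => (1 - s ^ k) / (1 - s ^ 2)) g h) (k : ℕ) :
    g (2 * k) = qfac (s ^ 2) k / (1 - s ^ 2) ^ k := by
  induction k with
  | zero => rw [mul_zero, H.zero]; simp [qfac]
  | succ k ih =>
    rw [show 2 * (k + 1) = 2 * k + 2 by ring, H.add_two, ih, qfac_succ, pow_succ (1 - s ^ 2),
      ← pow_mul, show 2 * (k + 1) = 2 * k + 2 by ring]
    generalize 1 - s ^ 2 = c
    ring

/-- Here `n = m + r` moves with `r`. After the reindexing of `prod_gammaFactor` the products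
telescope, and the leftover values at half-integers are eliminated in pairs by `halfGamma_mul`. -/
theorem prod_gammaFactor_succ (hs0 : 0 < s) (hs1 : s < 1)
    (H : IsHalfGamma (fun k => (1 - s ^ k) / (1 - s ^ 2)) g h) (m r : ℕ) :
    (∏ i ∈ Icc 1 (r + 1), gammaFactor g h (m + (r + 1)) i) *
      ((∏ j ∈ range m, (1 - s ^ (r + 3 + 2 * j))) ^ 2 * qfac (s ^ 2) (2 * (m + r)) ^ r *
        qfac (s ^ 2) (m + r) ^ 2 * qfac s (2 * (m + r) + 1) * (1 - s ^ 2) ^ (2 * r + 3)) =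
    (∏ i ∈ Icc 1 r, gammaFactor g h (m + r) i) *
      (qfac s (r + 2 * m + 1) ^ 2 * qfac (s ^ 2) (2 * (m + r + 1)) ^ (r + 1)) := by
  have hZ : (∏ l ∈ range (r + 1), g (2 * m + (r + 1) + l)) * g (2 * m + r) =
      (∏ l ∈ range r, g (2 * m + r + l)) * (g (2 * (m + r)) * g (2 * (m + r) + 1)) := by
    have h1 := prod_range_succ' (fun l => g (2 * m + r + l)) (r + 1)
    rw [prod_range_succ, prod_range_succ] at h1
    rw [add_zero, show 2 * m + r + r = 2 * (m + r) by ring,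
      show 2 * m + r + (r + 1) = 2 * (m + r) + 1 by ring] at h1
    rw [← mul_assoc, h1]
    congr 1
    refine prod_congr rfl fun l _ => ?_
    congr 1
    ring
  have hc : (0 : ℝ) < 1 - s ^ 2 := sub_pos.2 (pow_lt_one₀ hs0.le hs1 two_ne_zero)
  have hA3 : g (2 * m + r + 1) * (1 - s ^ 2) ^ m =
      g (r + 1) * ∏ j ∈ range m, (1 - s ^ (r + 3 + 2 * j)) := by
    rw [show 2 * m + r + 1 = r + 1 + 2 * m by ring, H.add_two_mul, prod_div_distrib, prod_const,
      card_range]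
    have : ∀ j, r + 1 + 2 * j + 2 = r + 3 + 2 * j := fun j => by ring
    simp only [this]
    field_simp
  have hv := halfGamma_mul H (2 * m + r)
  have hn := halfGamma_mul H (2 * (m + r))
  have hz : ∀ k, g k ≠ 0 := H.ne_zero
  rw [prod_gammaFactor, prod_gammaFactor, prod_range_succ, prod_range_succ _ r]
  have hZ0 : ∏ l ∈ range r, g (2 * m + r + l) ≠ 0 := prod_ne_zero_iff.2 fun _ _ => hz _
  have e0 : ∏ l ∈ range (r + 1), g (2 * m + (r + 1) + l) =
      (∏ l ∈ range r, g (2 * m + r + l)) * (g (2 * (m + r)) * g (2 * (m + r) + 1)) /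
        g (2 * m + r) := by
    rw [eq_div_iff (hz _), hZ]
  have hQs : ∀ k, qfac (s ^ 2) k ≠ 0 := fun k =>
    (qfac_pos (by positivity) (pow_lt_one₀ hs0.le hs1 two_ne_zero) k).ne'
  have hqs : ∀ k, qfac s k ≠ 0 := fun k => (qfac_pos hs0 hs1 k).ne'
  have hA30 : ∏ j ∈ range m, (1 - s ^ (r + 3 + 2 * j)) ≠ 0 :=
    prod_ne_zero_iff.2 fun j _ => (sub_pos.2 (pow_lt_one₀ hs0.le hs1 (by omega))).ne'
  have e1 : g (r + 1) = qfac s (r + 2 * m + 1) / (1 - s ^ 2) ^ (r + 2 * m + 1) * h *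
      (1 - s ^ 2) ^ m / (g (2 * m + r) * ∏ j ∈ range m, (1 - s ^ (r + 3 + 2 * j))) := by
    rw [eq_div_iff (mul_ne_zero (hz _) hA30), mul_left_comm, ← hA3, ← mul_assoc, hv,
      show 2 * m + r + 1 = r + 2 * m + 1 by ring]
  have e2 : g (2 * (m + r) + 1) = qfac s (2 * (m + r) + 1) / (1 - s ^ 2) ^ (2 * (m + r) + 1) * h /
      g (2 * (m + r)) := by
    rw [eq_div_iff (hz _), mul_comm, hn]
  rw [e0, e1, e2, show m + (r + 1) = m + r + 1 by ring,
    show 4 * (m + r + 1) = 2 * (2 * (m + r + 1)) by ring,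
    show 4 * (m + r) = 2 * (2 * (m + r)) by ring, halfGamma_even H (2 * (m + r + 1)),
    halfGamma_even H (2 * (m + r)), halfGamma_even H (m + r)]
  have c0 := hc.ne'
  have h0 := H.h_ne
  have f1 := hz (2 * m + r)
  have f2 := hQs (m + r)
  have f3 := hqs (2 * (m + r) + 1)
  have f4 := hQs (2 * (m + r))
  have f5 := hQs (2 * (m + r + 1))
  generalize ∏ l ∈ range r, g (l + 1) ^ 2 / h = X
  generalize ∏ l ∈ range r, g (2 * (m + l) + 1) / g (2 * (m + l)) = Y
  generalize ∏ l ∈ range r, g (2 * m + r + l) = Z at *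
  generalize ∏ j ∈ range m, (1 - s ^ (r + 3 + 2 * j)) = A3 at *
  generalize qfac (s ^ 2) (2 * (m + r + 1)) = Q2 at *
  generalize qfac (s ^ 2) (2 * (m + r)) = Q0 at *
  generalize qfac (s ^ 2) (m + r) = F0 at *
  generalize qfac s (2 * (m + r) + 1) = Aq at *
  generalize 1 - s ^ 2 = c at *
  clear e0 e1 e2 hA3 hv hn hZ
  simp only [div_pow, mul_pow, ← pow_mul]
  field_simp
  ring

end QuantumGamma

/-! ### The prefactor and the closed form of the `q`-sum -/

/-- The factor multiplying the product of Gamma functions, with `q = s²` and `n = m + r`. -/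
def qPref (s : ℝ) (m r : ℕ) : ℝ :=
  2 ^ r * ((r.factorial : ℝ) / qFactorial (s ^ 2) r) *
    (qPoch (-1) s ((r : ℤ) + 1) * (∏ j ∈ range m, (1 + s ^ (r + 2 + 2 * j))) /
      qPoch (-1) (s ^ 2) m) *
    ((∏ l ∈ range (r + 1), sfac s l) * (∏ l ∈ range (r + 1), qPoch (-s) s (2 * (m : ℤ) - 1 + l)) /
      ∏ l ∈ range (r + 1), sfac s (2 * m + 2 * l))

theorem qPoch_neg_one_pos {s : ℝ} (hs : 0 < s) (m : ℕ) : 0 < qPoch (-1) s m :=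
  prod_pos fun k _ => by
    have := pow_pos hs k
    linarith

theorem qPref_zero {s : ℝ} (hs : 0 < s) (m : ℕ) : qPref s m 0 = 1 := by
  have h1 : qPoch (-1) s 1 = 2 := by
    change ∏ k ∈ range 1, (1 - (-1) * s ^ k) = 2
    norm_num
  have hp := (qPoch_neg_one_pos (pow_pos hs 2) m).ne'
  have key : 2 * (∏ j ∈ range m, (1 + s ^ (2 + 2 * j))) * qPoch (-s) s (2 * (m : ℤ) - 1) =
      qPoch (-1) (s ^ 2) m * sfac s (2 * m) := by
    cases m with
    | zero =>
      -- The index `2m - 1` is negative only for `m = 0`, where `(-s;s)_{-1} = 1/(1 + 1)`.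
      have : qPoch (-s) s (-1) = 2⁻¹ := by
        change ∏ k ∈ range 1, (1 - (-s) * s ^ (-((k : ℤ) + 1)))⁻¹ = 2⁻¹
        simp [hs.ne']
        norm_num
      simp [this, sfac]
      exact rfl
    | succ m =>
      rw [show 2 * ((m + 1 : ℕ) : ℤ) - 1 = ((2 * m + 1 : ℕ) : ℤ) by push_cast; ring,
        qPoch_neg_self, show 2 * (m + 1) = 2 * m + 1 + 1 by ring, sfac_succ s (2 * m + 1),
        qPoch_natCast, prod_range_succ' (fun k => 1 - -1 * (s ^ 2) ^ k),
        prod_range_succ (fun j => 1 + s ^ (2 + 2 * j))]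
      have : ∀ k : ℕ, 1 - -1 * (s ^ 2) ^ (k + 1) = 1 + s ^ (2 + 2 * k) := fun k => by
        rw [← pow_mul]; ring
      simp only [this]
      ring
  have hs2 := (sfac_pos hs (2 * m)).ne'
  simp only [qPref, Nat.cast_zero, zero_add, h1, range_one, prod_singleton, Nat.cast_zero, add_zero, mul_zero]
  rw [show sfac s 0 = 1 from rfl, show qFactorial (s ^ 2) 0 = 1 by simp [qFactorial]]
  rw [pow_zero, Nat.factorial_zero, Nat.cast_one, div_one, one_mul, one_mul, one_mul,
    div_mul_div_comm, key, div_self (mul_ne_zero hp hs2)]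

theorem qPref_succ {s : ℝ} (hs : 0 < s) (hs1 : s < 1) (m r : ℕ) :
    qPref s m (r + 1) * ((1 - s ^ (r + 1)) * (∏ j ∈ range m, (1 + s ^ (r + 2 + 2 * j))) *
      sfac s (2 * (m + r + 1))) =
    qPref s m r * (2 * (r + 1) * (1 - s ^ 2) * (∏ j ∈ range m, (1 + s ^ (r + 3 + 2 * j))) *
      sfac s (r + 1) * sfac s (r + 2 * m)) := by
  have hF : qFactorial (s ^ 2) (r + 1) =
      qFactorial (s ^ 2) r * ((1 - s ^ (r + 1)) * (1 + s ^ (r + 1)) / (1 - s ^ 2)) := by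
    rw [qFactorial, prod_Icc_succ_top (by omega), qFactorial, qNum, zpow_natCast, ← pow_mul, mul_comm 2, pow_mul]
    ring
  have hF0 : qFactorial (s ^ 2) r ≠ 0 := by
    refine prod_ne_zero_iff.2 fun i hi => ?_
    have := (mem_Icc.1 hi).1
    have h2 : s ^ 2 < 1 := pow_lt_one₀ hs.le hs1 two_ne_zero
    rw [qNum, zpow_natCast]
    exact (div_pos (sub_pos.2 (pow_lt_one₀ (by positivity) h2 (by omega))) (sub_pos.2 h2)).ne'
  have hQ : qPoch (-1) s (((r + 1 : ℕ) : ℤ) + 1) = qPoch (-1) s ((r : ℤ) + 1) * (1 + s ^ (r + 1)) := by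
    change ∏ k ∈ range (r + 1 + 1), (1 - (-1) * s ^ k) =
      (∏ k ∈ range (r + 1), (1 - (-1) * s ^ k)) * (1 + s ^ (r + 1))
    rw [prod_range_succ]
    ring
  have hZ : qPoch (-s) s (2 * (m : ℤ) - 1 + ((r + 1 : ℕ) : ℤ)) = sfac s (r + 2 * m) := by
    rw [← qPoch_neg_self]
    congr 1
    push_cast; ring
  have hE : ∀ j, r + 1 + 2 + 2 * j = r + 3 + 2 * j := fun j => by ring
  simp only [qPref, hF, hQ, hE, prod_range_succ _ (r + 1), hZ, Nat.factorial_succ]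
  have c0 : 1 - s ^ 2 ≠ 0 := (sub_pos.2 (pow_lt_one₀ hs.le hs1 two_ne_zero)).ne'
  have c1 : 1 - s ^ (r + 1) ≠ 0 := (sub_pos.2 (pow_lt_one₀ hs.le hs1 (by omega))).ne'
  have c2 : 1 + s ^ (r + 1) ≠ 0 := by positivity
  have c3 := (sfac_pos hs (2 * (m + r + 1))).ne'
  have c4 := (qPoch_neg_one_pos (pow_pos hs 2) m).ne'
  have c5 : ∏ l ∈ range (r + 1), sfac s (2 * m + 2 * l) ≠ 0 :=
    prod_ne_zero_iff.2 fun _ _ => (sfac_pos hs _).ne'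
  rw [show 2 * m + 2 * (r + 1) = 2 * (m + r + 1) by ring]
  push_cast
  generalize ∏ l ∈ range (r + 1), sfac s (2 * m + 2 * l) = W at *
  generalize qPoch (-1) (s ^ 2) m = Q at *
  generalize qFactorial (s ^ 2) r = F at *
  generalize sfac s (2 * (m + r + 1)) = S at *
  generalize ∏ j ∈ range m, (1 + s ^ (r + 2 + 2 * j)) = E
  generalize ∏ j ∈ range m, (1 + s ^ (r + 3 + 2 * j)) = E'
  generalize ∏ l ∈ range (r + 1), qPoch (-s) s (2 * (m : ℤ) - 1 + l) = V
  generalize ∏ l ∈ range (r + 1), sfac s l = U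
  generalize 1 - s ^ 2 = c at *
  generalize 1 - s ^ (r + 1) = d at *
  generalize 1 + s ^ (r + 1) = e at *
  field_simp
  ring

theorem prod_one_add_interleave (s : ℝ) (m r : ℕ) :
    (∏ j ∈ range m, (1 + s ^ (r + 2 + 2 * j))) * (∏ j ∈ range m, (1 + s ^ (r + 3 + 2 * j))) *
      sfac s (r + 1) = sfac s (r + 2 * m + 1) := by
  induction m with
  | zero => simp
  | succ m ih =>
    rw [prod_range_succ, prod_range_succ, show r + 2 * (m + 1) + 1 = r + 2 * m + 1 + 1 + 1 by ring,
      sfac_succ s (r + 2 * m + 1 + 1), sfac_succ s (r + 2 * m + 1), ← ih,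
      show r + 2 * m + 1 + 1 = r + 2 + 2 * m by ring,
      show r + 2 + 2 * m + 1 = r + 3 + 2 * m by ring]
    ring

theorem prod_one_sub_shift (s : ℝ) (m r : ℕ) :
    (1 - s ^ (r + 1)) * ∏ j ∈ range m, (1 - s ^ (r + 3 + 2 * j)) =
      (∏ j ∈ range m, (1 - s ^ (r + 1 + 2 * j))) * (1 - s ^ (r + 2 * m + 1)) := by
  have h := prod_range_succ' (fun j => 1 - s ^ (r + 1 + 2 * j)) m
  rw [prod_range_succ] at h
  rw [show r + 2 * m + 1 = r + 1 + 2 * m by ring, h, mul_comm]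
  congr 1
  refine prod_congr rfl fun j _ => ?_
  rw [show r + 3 + 2 * j = r + 1 + 2 * (j + 1) by ring]

/-- Induction on `r` with `m` fixed: the three recurrences for the sum, the prefactor and the Gamma
product are compatible once `(s²;s²)_j` is split as `(s;s)_j (-s;s)_j` and the products over
alternate exponents are interleaved. -/
theorem qSumValue_eq {P : ℝ} (hP : 1 < P) {g : ℕ → ℝ} {h : ℝ}
    (H : IsHalfGamma (fun k => (1 - ((P ^ 2)⁻¹) ^ k) / (1 - ((P ^ 2)⁻¹) ^ 2)) g h) (m r : ℕ) :
    qSumValue P m r = qPref (P ^ 2)⁻¹ m r * ∏ i ∈ Icc 1 r, gammaFactor g h (m + r) i := by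
  have hs : 0 < (P ^ 2)⁻¹ := by positivity
  have hs1 : (P ^ 2)⁻¹ < 1 := inv_lt_one_of_one_lt₀ (one_lt_pow₀ hP (by norm_num))
  have hq : (P ^ 4)⁻¹ = ((P ^ 2)⁻¹) ^ 2 := by rw [inv_pow, ← pow_mul]
  induction r with
  | zero => simp [qSumValue_zero hP, qPref_zero hs]
  | succ r ih =>
    have h1 := qSumValue_succ hP m r
    have h2 := qPref_succ hs hs1 m r
    have h3 := prod_gammaFactor_succ hs hs1 H m r
    rw [hq, ih] at h1
    clear ih H
    generalize (P ^ 2)⁻¹ = s at *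
    have a1 := prod_one_sub_shift s m r
    have a2 := prod_one_add_interleave s m r
    have b1 := qfac_succ s (2 * (m + r) + 1)
    have b2 := qfac_succ (s ^ 2) (m + r)
    have b3 := qfac_succ s (r + 2 * m)
    have b4 := qfac_sq s (r + 2 * m)
    have b5 := qfac_sq s (r + 2 * m + 1)
    have b6 := qfac_sq s (2 * (m + r + 1))
    rw [show 2 * (m + r) + 1 + 1 = 2 * (m + r + 1) by ring] at b1
    rw [← pow_mul] at b2
    have hd : ∀ k, 0 < 1 - s ^ (k + 1) := fun k =>
      sub_pos.2 (pow_lt_one₀ hs.le hs1 (Nat.succ_ne_zero k))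
    have hQ : ∀ k, qfac (s ^ 2) k ≠ 0 := fun k =>
      (qfac_pos (pow_pos hs 2) (pow_lt_one₀ hs.le hs1 two_ne_zero) k).ne'
    have c1 := (hd 1).ne'
    have c2 := (hd r).ne'
    have c3 := (hd (r + 2 * m)).ne'
    have c4 := hQ (m + r)
    have c5 := hQ (2 * (m + r))
    have c6 := (qfac_pos hs hs1 (2 * (m + r) + 1)).ne'
    have c7 := (qfac_pos hs hs1 (r + 2 * m)).ne'
    have c8 := (sfac_pos hs (2 * (m + r + 1))).ne'
    have c9 := (sfac_pos hs (r + 1)).ne'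
    have c10 := (sfac_pos hs (r + 2 * m)).ne'
    have d1 : ∏ j ∈ range m, (1 - s ^ (r + 1 + 2 * j)) ≠ 0 :=
      prod_ne_zero_iff.2 fun j _ => (sub_pos.2 (pow_lt_one₀ hs.le hs1 (by omega))).ne'
    have d2 : ∏ j ∈ range m, (1 - s ^ (r + 3 + 2 * j)) ≠ 0 :=
      prod_ne_zero_iff.2 fun j _ => (sub_pos.2 (pow_lt_one₀ hs.le hs1 (by omega))).ne'
    have d3 : ∏ j ∈ range m, (1 + s ^ (r + 2 + 2 * j)) ≠ 0 :=
      prod_ne_zero_iff.2 fun j _ => by positivity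
    rw [show 1 + 1 = 2 by norm_num] at c1
    clear hd hQ
    generalize ∏ i ∈ Icc 1 (r + 1), gammaFactor g h (m + (r + 1)) i = G' at *
    generalize ∏ i ∈ Icc 1 r, gammaFactor g h (m + r) i = Γ at *
    generalize qPref s m (r + 1) = p' at *
    generalize qPref s m r = p at *
    generalize qSumValue P m (r + 1) = v' at *
    rw [pow_succ (qfac (s ^ 2) (2 * (m + r + 1)))] at h3
    rw [b4, b5, b2, b3, ← a2, ← pow_mul] at h1
    have hcc : (1 - s ^ 2) ^ (2 * r + 3) = (1 - s ^ 2) ^ (2 * (r + 1)) * (1 - s ^ 2) := by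
      ring
    rw [b3, hcc] at h3
    generalize qfac (s ^ 2) (2 * (m + r + 1)) ^ r = Q2r at *
    have c5' := pow_ne_zero r c5
    have c1' := pow_ne_zero (2 * (r + 1)) c1
    rw [b6, b1] at h3
    clear b1 b2 b3 b4 b5 b6 a2 hcc
    generalize qfac (s ^ 2) (2 * (m + r)) ^ r = Q0r at *
    generalize (1 - s ^ 2) ^ (2 * (r + 1)) = cr at *
    generalize 1 - s ^ 2 = c at *
    generalize qfac (s ^ 2) (m + r) = F0 at *
    generalize qfac s (2 * (m + r) + 1) = Aq at *
    generalize qfac s (r + 2 * m) = A0 at *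
    generalize 1 - s ^ (2 * (m + r + 1)) = z at *
    generalize 1 - s ^ (r + 2 * m + 1) = y at *
    generalize 1 - s ^ (r + 1) = x at *
    generalize sfac s (2 * (m + r + 1)) = S2 at *
    generalize sfac s (r + 2 * m) = S0 at *
    generalize sfac s (r + 1) = S1 at *
    generalize ∏ j ∈ range m, (1 - s ^ (r + 1 + 2 * j)) = A1 at *
    generalize ∏ j ∈ range m, (1 - s ^ (r + 3 + 2 * j)) = A3 at *
    generalize ∏ j ∈ range m, (1 + s ^ (r + 2 + 2 * j)) = E at *
    generalize ∏ j ∈ range m, (1 + s ^ (r + 3 + 2 * j)) = E' at *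
    have e0 : A1 = x * A3 / y := by rw [eq_div_iff c3, a1]
    have e1 := eq_div_of_mul_eq (by positivity) h1
    have e2 := eq_div_of_mul_eq (by positivity) h2
    have e3 := eq_div_of_mul_eq (by positivity) h3
    rw [e1, e2, e3, e0]
    field_simp

/-! ### The `q`-Gamma function -/

section QGamma

variable {q : ℝ}

theorem summable_norm_mul_pow (h0 : 0 < q) (h1 : q < 1) (a : ℝ) :
    Summable fun k : ℕ => ‖-(a * q ^ k)‖ := by
  have := (summable_geometric_of_lt_one h0.le h1).mul_left |a|
  refine this.congr fun k => ?_
  rw [norm_neg, Real.norm_eq_abs, abs_mul, abs_of_pos (pow_pos h0 k)]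

theorem qPochInf_eq_mul (h0 : 0 < q) (h1 : q < 1) (a : ℝ) :
    qPochInf a q = (1 - a) * qPochInf (a * q) q := by
  have e : (fun k : ℕ => 1 + -(a * q * q ^ k)) = fun k : ℕ => 1 - a * q ^ (k + 1) := by
    funext k
    ring
  have hm : Multipliable fun k : ℕ => 1 - a * q ^ (k + 1) :=
    e ▸ multipliable_one_add_of_summable (summable_norm_mul_pow h0 h1 (a * q))
  have h := tprod_eq_zero_mul' (f := fun k : ℕ => 1 - a * q ^ k) hm
  rw [qPochInf, h, qPochInf, pow_zero, mul_one]
  congr 1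
  exact tprod_congr fun k => by ring

theorem qPochInf_ne_zero (h0 : 0 < q) (h1 : q < 1) {a : ℝ} (ha1 : a < 1) (ha0 : 0 < a) :
    qPochInf a q ≠ 0 := by
  have h := tprod_one_add_ne_zero_of_summable (f := fun k : ℕ => -(a * q ^ k)) (fun k => by
    have : a * q ^ k < 1 :=
      mul_lt_one_of_nonneg_of_lt_one_left ha0.le ha1 (pow_le_one₀ h0.le h1.le)
    linarith) (summable_norm_mul_pow h0 h1 a)
  have e : qPochInf a q = ∏' k : ℕ, (1 + -(a * q ^ k)) := tprod_congr fun k => by ring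
  rw [e]
  exact h

theorem qGamma_add_one (h0 : 0 < q) (h1 : q < 1) {x : ℝ} (hx : 0 < x) :
    qGamma q (x + 1) = (1 - q ^ x) / (1 - q) * qGamma q x := by
  have hc : 0 < 1 - q := by linarith
  have hqx : q ^ x < 1 := Real.rpow_lt_one h0.le h1 hx
  have hqx0 : 0 < q ^ x := Real.rpow_pos_of_pos h0 x
  have hq1 := qPochInf_ne_zero h0 h1 (a := q ^ (x + 1)) (Real.rpow_lt_one h0.le h1 (by linarith))
    (Real.rpow_pos_of_pos h0 _)
  rw [qGamma, qGamma, qPochInf_eq_mul h0 h1 (q ^ x), ← Real.rpow_add_one h0.ne',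
    show 1 - (x + 1) = 1 - x - 1 by ring, Real.rpow_sub_one hc.ne']
  have : 1 - q ^ x ≠ 0 := by linarith
  field_simp

theorem qGamma_one (h0 : 0 < q) (h1 : q < 1) : qGamma q 1 = 1 := by
  rw [qGamma, Real.rpow_one, div_self (qPochInf_ne_zero h0 h1 h1 h0)]
  simp

theorem qGamma_ne_zero (h0 : 0 < q) (h1 : q < 1) {x : ℝ} (hx : 0 < x) : qGamma q x ≠ 0 :=
  mul_ne_zero (Real.rpow_pos_of_pos (by linarith) _).ne' (div_ne_zero
    (qPochInf_ne_zero h0 h1 h1 h0) (qPochInf_ne_zero h0 h1 (Real.rpow_lt_one h0.le h1 hx)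
      (Real.rpow_pos_of_pos h0 _)))

end QGamma

/-- A function satisfying the functional equation of a Gamma function on the positive reals. -/
theorem isHalfGamma_of_add_one {G M : ℝ → ℝ} (h1 : G 1 = 1)
    (hadd : ∀ x, 0 < x → G (x + 1) = M x * G x) (hG : G (1 / 2) ≠ 0) (hM : ∀ x, 0 < x → M x ≠ 0) :
    IsHalfGamma (fun k => M ((k : ℝ) / 2)) (fun k => G (1 + (k : ℝ) / 2)) (G (1 / 2)) where
  h_ne := hG
  zero := by simp [h1]
  one := by
    rw [Nat.cast_one, add_comm, hadd _ (by norm_num)]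
  add_two k := by
    rw [show 1 + ((k + 2 : ℕ) : ℝ) / 2 = ((k + 2 : ℕ) : ℝ) / 2 + 1 by ring,
      hadd _ (by positivity)]
    congr 2
    push_cast; ring
  N_ne k hk := hM _ (by have : (0 : ℝ) < k := by exact_mod_cast Nat.pos_of_ne_zero hk
                        positivity)

theorem gammaFactor_eq (G : ℝ → ℝ) {n i : ℕ} (hi : i ≤ n) :
    G (1 + (i : ℝ) / 2) ^ 2 / G (1 / 2) *
      (G (2 * (n : ℝ) + 1) * G ((n : ℝ) - i + 3 / 2) /
        (G ((n : ℝ) - i + 1) * G ((n : ℝ) - (i : ℝ) / 2 + 1) ^ 2)) =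
    gammaFactor (fun k => G (1 + (k : ℝ) / 2)) (G (1 / 2)) n i := by
  have h1 : ((n - i : ℕ) : ℝ) = n - i := Nat.cast_sub hi
  have h2 : ((2 * n - i : ℕ) : ℝ) = 2 * n - i := by
    rw [Nat.cast_sub (by omega)]; push_cast; ring
  rw [gammaFactor]
  push_cast
  rw [h1, h2, show 1 + 4 * (n : ℝ) / 2 = 2 * n + 1 by ring,
    show 1 + (2 * ((n : ℝ) - i) + 1) / 2 = n - i + 3 / 2 by ring,
    show 1 + 2 * ((n : ℝ) - i) / 2 = n - i + 1 by ring,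
    show 1 + (2 * (n : ℝ) - i) / 2 = n - i / 2 + 1 by ring]

theorem qGamma_isHalfGamma {q : ℝ} (h0 : 0 < q) (h1 : q < 1) :
    IsHalfGamma (fun k => (1 - (q ^ (1 / 2 : ℝ)) ^ k) / (1 - (q ^ (1 / 2 : ℝ)) ^ 2))
      (fun k => qGamma q (1 + (k : ℝ) / 2)) (qGamma q (1 / 2)) := by
  have h := isHalfGamma_of_add_one (G := qGamma q) (M := fun x => (1 - q ^ x) / (1 - q))
    (qGamma_one h0 h1) (fun x hx => qGamma_add_one h0 h1 hx)
    (qGamma_ne_zero h0 h1 (by norm_num)) fun x hx =>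
      div_ne_zero (by linarith [Real.rpow_lt_one h0.le h1 hx]) (by linarith)
  convert h using 4 with k
  · rw [← Real.rpow_natCast, ← Real.rpow_mul h0.le]
    congr 1
    ring
  · rw [← Real.rpow_natCast, ← Real.rpow_mul h0.le]
    norm_num

/-- The factor multiplying the product of Gamma functions in the closed form of the `q`-sum. -/
def qPrefactor (q : ℝ) (r n : ℕ) : ℝ :=
  2 ^ r * ((r.factorial : ℝ) / qFactorial q r) *
          (qPoch (-1) (q ^ (1 / 2 : ℝ)) ((r : ℤ) + 1) *
              qPoch (-q ^ ((r : ℝ) / 2 + 1)) q ((n : ℤ) - r) /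
            qPoch (-1) q ((n : ℤ) - r)) *
          (∏ i ∈ Icc 1 (r + 1),
            qPoch (-q ^ (1 / 2 : ℝ)) (q ^ (1 / 2 : ℝ)) ((i : ℤ) - 1) *
                qPoch (-q ^ (1 / 2 : ℝ)) (q ^ (1 / 2 : ℝ)) (2 * (n : ℤ) - i - r) /
              qPoch (-q ^ (1 / 2 : ℝ)) (q ^ (1 / 2 : ℝ)) (2 * (n : ℤ) - 2 * i + 2))

theorem qPrefactor_eq {q : ℝ} (h0 : 0 < q) (m r : ℕ) :
    qPrefactor q r (m + r) = qPref (q ^ (1 / 2 : ℝ)) m r := by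
  have hs : (q ^ (1 / 2 : ℝ)) ^ 2 = q := by
    rw [← Real.rpow_natCast, ← Real.rpow_mul h0.le]; norm_num
  have h1 : q ^ ((r : ℝ) / 2 + 1) = (q ^ (1 / 2 : ℝ)) ^ (r + 2) := by
    rw [← Real.rpow_natCast, ← Real.rpow_mul h0.le]
    congr 1
    push_cast; ring
  have h2 : qPoch (-q ^ ((r : ℝ) / 2 + 1)) q m =
      ∏ j ∈ range m, (1 + (q ^ (1 / 2 : ℝ)) ^ (r + 2 + 2 * j)) := by
    rw [h1, qPoch_natCast]
    refine prod_congr rfl fun j _ => ?_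
    rw [neg_mul, sub_neg_eq_add, pow_add _ (r + 2), pow_mul _ 2 j, hs]
  have h3 : ∀ f : ℕ → ℝ, ∏ i ∈ Icc 1 (r + 1), f i = ∏ l ∈ range (r + 1), f (l + 1) := fun f => by
    rw [range_eq_Ico, prod_Ico_add']
    rfl
  have hA : ∏ l ∈ range (r + 1), qPoch (-q ^ (1 / 2 : ℝ)) (q ^ (1 / 2 : ℝ)) (((l + 1 : ℕ) : ℤ) - 1) =
      ∏ l ∈ range (r + 1), sfac (q ^ (1 / 2 : ℝ)) l := by
    refine prod_congr rfl fun l _ => ?_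
    rw [← qPoch_neg_self]
    congr 1
    push_cast; ring
  have hB : ∏ l ∈ range (r + 1), qPoch (-q ^ (1 / 2 : ℝ)) (q ^ (1 / 2 : ℝ))
        (2 * ((m + r : ℕ) : ℤ) - (l + 1 : ℕ) - r) =
      ∏ l ∈ range (r + 1), qPoch (-q ^ (1 / 2 : ℝ)) (q ^ (1 / 2 : ℝ)) (2 * (m : ℤ) - 1 + l) := by
    rw [← prod_range_reflect]
    refine prod_congr rfl fun l hl => ?_
    have := mem_range.1 hl
    congr 1
    omega
  have hC : ∏ l ∈ range (r + 1), qPoch (-q ^ (1 / 2 : ℝ)) (q ^ (1 / 2 : ℝ))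
        (2 * ((m + r : ℕ) : ℤ) - 2 * (l + 1 : ℕ) + 2) =
      ∏ l ∈ range (r + 1), sfac (q ^ (1 / 2 : ℝ)) (2 * m + 2 * l) := by
    rw [← prod_range_reflect]
    refine prod_congr rfl fun l hl => ?_
    have := mem_range.1 hl
    rw [← qPoch_neg_self]
    congr 1
    omega
  rw [qPrefactor, qPref, show ((m + r : ℕ) : ℤ) - r = m by push_cast; ring, h2, hs,
    prod_div_distrib, prod_mul_distrib, h3, h3, h3, hA, hB, hC]

/-- The sum on the left-hand side of the `q`-identity. -/
def qSum (q : ℝ) (r n : ℕ) : ℝ :=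
  ∑ k ∈ box r n,
        (∏ i : Fin r, ∏ j ∈ Ioi i, |qNum q (k i - k j) * qNum q (k i + k j)|) *
          ∏ i : Fin r,
            qNum q (k i) ^ 2 *
              q ^ (((k i : ℝ) - (r : ℝ) + (((i : ℕ) : ℝ) + 1) - 1) ^ 2 / 2) *
              qBinom q (2 * (n : ℤ)) ((n : ℤ) + k i)

theorem qSum_eq_gammaFactor {q : ℝ} (h0 : 0 < q) (h1 : q < 1) {r n : ℕ} (hrn : r ≤ n) :
    qSum q r n = qPrefactor q r n *
      ∏ i ∈ Icc 1 r, gammaFactor (fun k => qGamma q (1 + (k : ℝ) / 2)) (qGamma q (1 / 2)) n i := by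
  obtain ⟨m, rfl⟩ := Nat.exists_eq_add_of_le' hrn
  -- The fourth root makes the brackets `P^k - P^{-k}` with odd `k`, that is `q^{-k/4} - q^{k/4}`,
  -- integral powers of the parameter.
  set P := q ^ (-(1 / 4) : ℝ) with hPdef
  have hP : 1 < P := Real.one_lt_rpow_of_pos_of_lt_one_of_neg h0 h1 (by norm_num)
  have hP4 : (P ^ 4)⁻¹ = q := by
    rw [hPdef, ← Real.rpow_natCast, ← Real.rpow_mul h0.le, ← Real.rpow_neg h0.le]
    norm_num
  have hP2 : (P ^ 2)⁻¹ = q ^ (1 / 2 : ℝ) := by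
    rw [hPdef, ← Real.rpow_natCast, ← Real.rpow_mul h0.le, ← Real.rpow_neg h0.le]
    norm_num
  have hsum := q_sum_eq hP m r
  rw [hP4] at hsum
  have hG := qGamma_isHalfGamma h0 h1
  rw [← hP2] at hG
  have hval := qSumValue_eq hP hG m r
  rw [hP2] at hval
  rw [qPrefactor_eq h0, ← hval, qSumValue, hP4]
  exact hsum

/-! ### The limit `q → 1⁻` -/

section Limit

open Filter Topology

theorem tendsto_rpow_one (a : ℝ) : Tendsto (fun q : ℝ => q ^ a) (𝓝[<] 1) (𝓝 1) := by
  have h := (Real.continuousAt_rpow_const 1 a (Or.inl one_ne_zero)).tendsto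
  rw [Real.one_rpow] at h
  exact h.mono_left nhdsWithin_le_nhds

theorem eventually_mem_Ioo : ∀ᶠ q : ℝ in 𝓝[<] 1, 0 < q ∧ q < 1 :=
  Ioo_mem_nhdsLT one_pos

theorem tendsto_sqrt_nhdsLT :
    Tendsto (fun q : ℝ => q ^ (1 / 2 : ℝ)) (𝓝[<] 1) (𝓝[<] 1) :=
  tendsto_nhdsWithin_iff.2 ⟨tendsto_rpow_one _, by
    filter_upwards [eventually_mem_Ioo] with q hq
    exact Real.rpow_lt_one hq.1.le hq.2 (by norm_num)⟩

/-- `[k]_q` is the slope of `x ↦ x^k` between `1` and `q`, so its limit is the derivative at `1`. -/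
theorem tendsto_qNum (k : ℤ) : Tendsto (fun q => qNum q k) (𝓝[<] 1) (𝓝 (k : ℝ)) := by
  have h := hasDerivAt_iff_tendsto_slope.1 (hasDerivAt_zpow (𝕜 := ℝ) k 1 (Or.inl one_ne_zero))
  rw [one_zpow, mul_one] at h
  refine (h.mono_left (nhdsLT_le_nhdsNE 1)).congr fun q => ?_
  rw [slope_def_field, one_zpow, qNum, ← neg_sub 1 q, ← neg_sub 1 (q ^ k), neg_div_neg_eq]

theorem tendsto_qFactorial (n : ℕ) :
    Tendsto (fun q => qFactorial q n) (𝓝[<] 1) (𝓝 (n.factorial : ℝ)) := by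
  have h := tendsto_finsetProd (Icc 1 n) fun i _ => tendsto_qNum (i : ℤ)
  simp only [Int.cast_natCast] at h
  have e : ∏ i ∈ Icc 1 n, i = n.factorial := prod_Ico_id_eq_factorial n
  rwa [← Nat.cast_prod, e] at h

theorem qfac_eq_qFactorial {q : ℝ} (h1 : q < 1) (n : ℕ) :
    qfac q n = (1 - q) ^ n * qFactorial q n := by
  have hc : 1 - q ≠ 0 := by linarith
  induction n with
  | zero => simp [qfac, qFactorial]
  | succ n ih =>
    rw [qfac_succ, ih, qFactorial, qFactorial, prod_Icc_succ_top (by omega), qNum, zpow_natCast,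
      pow_succ]
    field_simp
    ring

theorem tendsto_qBinom (n : ℕ) (k : ℤ) (hk : k ∈ Icc (-(n : ℤ)) n) :
    Tendsto (fun q => qBinom q (2 * (n : ℤ)) ((n : ℤ) + k)) (𝓝[<] 1)
      (𝓝 ((2 * n).choose ((n : ℤ) + k).toNat : ℝ)) := by
  have hk' := mem_Icc.1 hk
  have ha : k.natAbs ≤ n := by omega
  have e : ((2 * n).choose ((n : ℤ) + k).toNat : ℝ) = ((2 * n).factorial : ℝ) /
      ((n + k.natAbs).factorial * (n - k.natAbs).factorial) := by
    rcases Int.natAbs_eq k with h | h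
    · rw [Nat.cast_choose ℝ (by omega), show ((n : ℤ) + k).toNat = n + k.natAbs by omega,
        show 2 * n - (n + k.natAbs) = n - k.natAbs by omega]
    · rw [Nat.cast_choose ℝ (by omega), show ((n : ℤ) + k).toNat = n - k.natAbs by omega,
        show 2 * n - (n - k.natAbs) = n + k.natAbs by omega, mul_comm (Nat.cast _)]
  rw [e]
  refine ((tendsto_qFactorial _).div ((tendsto_qFactorial _).mul (tendsto_qFactorial _))
    (by positivity)).congr' ?_
  filter_upwards [eventually_mem_Ioo] with q hq
  have hc : 1 - q ≠ 0 := by linarith [hq.2]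
  rw [qBinom_central hq.1 hq.2 n k hk, qfac_eq_qFactorial hq.2, qfac_eq_qFactorial hq.2,
    qfac_eq_qFactorial hq.2, mul_mul_mul_comm, ← pow_add,
    show n + k.natAbs + (n - k.natAbs) = 2 * n by omega, mul_div_mul_left _ _ (pow_ne_zero _ hc)]
  rfl

/-- The sum on the left-hand side of the identity at `q = 1`. -/
def limitSum (r n : ℕ) : ℝ :=
  ∑ k ∈ box r n,
    (∏ i : Fin r, ∏ j ∈ Ioi i, |(k i : ℝ) ^ 2 - (k j : ℝ) ^ 2|) *
      ∏ i : Fin r, (k i : ℝ) ^ 2 * ((2 * n).choose ((n : ℤ) + k i).toNat : ℝ)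

theorem tendsto_qSum (r n : ℕ) :
    Tendsto (fun q => qSum q r n) (𝓝[<] 1) (𝓝 (limitSum r n)) := by
  refine tendsto_finsetSum _ fun k hk => Tendsto.mul ?_ ?_
  · refine tendsto_finsetProd _ fun i _ => tendsto_finsetProd _ fun j _ => ?_
    rw [show (k i : ℝ) ^ 2 - (k j : ℝ) ^ 2 = ((k i - k j : ℤ) : ℝ) * ((k i + k j : ℤ) : ℝ) by
      push_cast; ring]
    exact ((tendsto_qNum _).mul (tendsto_qNum _)).abs
  · refine tendsto_finsetProd _ fun i _ => ?_
    have h := (((tendsto_qNum (k i)).pow 2).mul (tendsto_rpow_one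
      (((k i : ℝ) - (r : ℝ) + (((i : ℕ) : ℝ) + 1) - 1) ^ 2 / 2))).mul
        (tendsto_qBinom n (k i) (Fintype.mem_piFinset.1 hk i))
    rwa [mul_one] at h

theorem tendsto_qPoch {a b : ℝ → ℝ} {l : Filter ℝ} (ha : Tendsto a l (𝓝 (-1)))
    (hb : Tendsto b l (𝓝 1)) (z : ℤ) :
    Tendsto (fun q => qPoch (a q) (b q) z) l (𝓝 (2 ^ z)) := by
  cases z with
  | ofNat n =>
    have h := tendsto_finsetProd (range n) fun k _ => (ha.mul (hb.pow k)).const_sub 1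
    norm_num at h
    simpa [qPoch] using h
  | negSucc m =>
    have h := tendsto_finsetProd (range (m + 1)) fun k _ =>
      ((ha.mul (hb.zpow₀ (-((k : ℤ) + 1)) (Or.inl one_ne_zero))).const_sub 1).inv₀ (by norm_num)
    norm_num at h
    simpa [qPoch] using h

theorem prod_two_zpow (R : ℕ) (c : ℤ) :
    ∏ i ∈ Icc 1 R, (2 : ℝ) ^ (2 * (i : ℤ) - c) = 2 ^ ((R : ℤ) * (R + 1 - c)) := by
  induction R with
  | zero => simp
  | succ R ih =>
    rw [prod_Icc_succ_top (by omega), ih, ← zpow_add₀ two_ne_zero]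
    congr 1
    push_cast
    ring

/-- Each shifted factorial of index `z` tends to `2^z`. The product over `i` contributes
`2^{-(r+1)}`, which cancels `(-1;q^{1/2})_{r+1}`, and the two factors of index `n - r` cancel each
other. -/
theorem tendsto_qPrefactor (r n : ℕ) :
    Tendsto (fun q => qPrefactor q r n) (𝓝[<] 1) (𝓝 (2 ^ r)) := by
  have hq : Tendsto (fun q : ℝ => q) (𝓝[<] 1) (𝓝 1) := nhdsWithin_le_nhds
  have hs := tendsto_rpow_one (1 / 2)
  have h2 : ∀ z : ℤ, (2 : ℝ) ^ z ≠ 0 := fun z => zpow_ne_zero z two_ne_zero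
  have hp := tendsto_finsetProd (Icc 1 (r + 1)) fun i _ =>
    ((tendsto_qPoch hs.neg hs ((i : ℤ) - 1)).mul
      (tendsto_qPoch hs.neg hs (2 * (n : ℤ) - i - r))).div
        (tendsto_qPoch hs.neg hs (2 * (n : ℤ) - 2 * i + 2)) (h2 _)
  have h := (((tendsto_const_nhds (x := (r.factorial : ℝ))).div (tendsto_qFactorial r)
    (by positivity)).const_mul (2 ^ r)).mul
      (((tendsto_qPoch tendsto_const_nhds hs ((r : ℤ) + 1)).mul
        (tendsto_qPoch (tendsto_rpow_one ((r : ℝ) / 2 + 1)).neg hq ((n : ℤ) - r))).div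
          (tendsto_qPoch tendsto_const_nhds hq ((n : ℤ) - r)) (h2 _)) |>.mul hp
  have e : ∏ i ∈ Icc 1 (r + 1), (2 : ℝ) ^ ((i : ℤ) - 1) * 2 ^ (2 * (n : ℤ) - i - r) /
      2 ^ (2 * (n : ℤ) - 2 * i + 2) = 2 ^ (-((r : ℤ) + 1)) := by
    have h3 := prod_two_zpow (r + 1) (r + 3)
    rw [show ((r + 1 : ℕ) : ℤ) * ((r + 1 : ℕ) + 1 - (r + 3)) = -((r : ℤ) + 1) by
      push_cast; ring] at h3
    rw [← h3]
    refine prod_congr rfl fun i _ => ?_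
    rw [← zpow_add₀ two_ne_zero, ← zpow_sub₀ two_ne_zero]
    congr 1
    ring
  rw [e, div_self (by positivity), mul_one, mul_div_cancel_right₀ _ (h2 _), mul_assoc,
    ← zpow_add₀ two_ne_zero, add_neg_cancel, zpow_zero, mul_one] at h
  exact h

theorem tendsto_gammaFinite (n i : ℕ) :
    Tendsto (fun q => gammaFinite
      (fun k => (1 - (q ^ (1 / 2 : ℝ)) ^ k) / (1 - (q ^ (1 / 2 : ℝ)) ^ 2)) n i) (𝓝[<] 1)
      (𝓝 (gammaFinite (fun k => (k : ℝ) / 2) n i)) := by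
  have hN : ∀ k : ℕ, Tendsto
      (fun q : ℝ => (1 - (q ^ (1 / 2 : ℝ)) ^ k) / (1 - (q ^ (1 / 2 : ℝ)) ^ 2)) (𝓝[<] 1)
      (𝓝 ((k : ℝ) / 2)) := fun k => by
    -- With `s = q^{1/2}` the quotient is `[k]_s / [2]_s`, and `s → 1⁻` as well.
    have h := ((tendsto_qNum (k : ℤ)).div (tendsto_qNum 2) (by norm_num)).comp
      tendsto_sqrt_nhdsLT
    norm_num only [Int.cast_natCast, Int.cast_ofNat] at h
    refine h.congr' ?_
    filter_upwards [eventually_mem_Ioo] with q hq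
    have : 1 - q ^ (1 / 2 : ℝ) ≠ 0 := by
      linarith [Real.rpow_lt_one hq.1.le hq.2 (show (0 : ℝ) < 1 / 2 by norm_num)]
    change qNum _ _ / qNum _ _ = _
    rw [qNum, qNum, div_div_div_cancel_right₀ this, zpow_natCast]
    rfl
  refine ((tendsto_finsetProd _ fun l _ => hN _).mul (tendsto_finsetProd _ fun l _ => hN _)).div
    ((tendsto_finsetProd _ fun l _ => hN _).pow 2) ?_
  exact pow_ne_zero _ (prod_ne_zero_iff.2 fun l _ => by positivity)

theorem limitSum_eq {r n : ℕ} (hrn : r ≤ n) :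
    limitSum r n = 2 ^ r * ∏ i ∈ Icc 1 r,
      gammaFactor (fun k => Real.Gamma (1 + (k : ℝ) / 2)) (Real.Gamma (1 / 2)) n i := by
  have hG := isHalfGamma_of_add_one (G := Real.Gamma) (M := fun x => x) Real.Gamma_one
    (fun x hx => Real.Gamma_add_one hx.ne') (Real.Gamma_pos_of_pos (by norm_num)).ne'
    fun x hx => hx.ne'
  have hle : ∀ i ∈ Icc 1 r, i ≤ n := fun i hi => (mem_Icc.1 hi).2.trans hrn
  -- Both sides are limits of the same `q`-sum, once directly and once through its closed form.
  refine tendsto_nhds_unique (tendsto_qSum r n) ?_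
  rw [prod_congr rfl fun i hi => gammaFactor_eq_finite hG (hle i hi)]
  refine ((tendsto_qPrefactor r n).mul
    (tendsto_finsetProd _ fun i _ => tendsto_gammaFinite n i)).congr' ?_
  filter_upwards [eventually_mem_Ioo] with q hq
  rw [qSum_eq_gammaFactor hq.1 hq.2 hrn, prod_congr rfl fun i hi =>
    gammaFactor_eq_finite (qGamma_isHalfGamma hq.1 hq.2) (hle i hi)]

end Limit

theorem discreteMacdonaldMehta_eq_limitSum (r n : ℕ) :
    discreteMacdonaldMehta r n 2 (1 / 2) 2 = limitSum r n := by
  refine sum_congr rfl fun k _ => ?_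
  rw [show (2 * (1 / 2) : ℝ) = 1 by norm_num, Real.rpow_one, vandermonde, abs_prod]
  congr 1
  · exact prod_congr rfl fun i _ => abs_prod _ _
  · exact prod_congr rfl fun i _ => by rw [sq_abs]

end DiscreteMM

end

open DiscreteMM in
open Finset in
/-- The index `i : Fin r` on the left-hand side starts at `0`, so `(i : ℕ) + 1` is the
one-based index of the variable `k i`. -/
theorem mainTheorem7 (r n : ℕ) (hr : 1 ≤ r) (hrn : r ≤ n) :
    (∀ q : ℝ, 0 < q → q < 1 →
      ∑ k ∈ box r n,
        (∏ i : Fin r, ∏ j ∈ Ioi i, |qNum q (k i - k j) * qNum q (k i + k j)|) *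
          ∏ i : Fin r,
            qNum q (k i) ^ 2 *
              q ^ (((k i : ℝ) - (r : ℝ) + (((i : ℕ) : ℝ) + 1) - 1) ^ 2 / 2) *
              qBinom q (2 * (n : ℤ)) ((n : ℤ) + k i)
      = 2 ^ r * ((r.factorial : ℝ) / qFactorial q r) *
          (qPoch (-1) (q ^ (1 / 2 : ℝ)) ((r : ℤ) + 1) *
              qPoch (-q ^ ((r : ℝ) / 2 + 1)) q ((n : ℤ) - r) /
            qPoch (-1) q ((n : ℤ) - r)) *
          (∏ i ∈ Icc 1 (r + 1),
            qPoch (-q ^ (1 / 2 : ℝ)) (q ^ (1 / 2 : ℝ)) ((i : ℤ) - 1) *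
                qPoch (-q ^ (1 / 2 : ℝ)) (q ^ (1 / 2 : ℝ)) (2 * (n : ℤ) - i - r) /
              qPoch (-q ^ (1 / 2 : ℝ)) (q ^ (1 / 2 : ℝ)) (2 * (n : ℤ) - 2 * i + 2)) *
          ∏ i ∈ Icc 1 r,
            qGamma q (1 + (i : ℝ) / 2) ^ 2 / qGamma q (1 / 2) *
              (qGamma q (2 * (n : ℝ) + 1) * qGamma q ((n : ℝ) - i + 3 / 2) /
                (qGamma q ((n : ℝ) - i + 1) * qGamma q ((n : ℝ) - (i : ℝ) / 2 + 1) ^ 2))) ∧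
    discreteMacdonaldMehta r n 2 (1 / 2) 2
      = ∑ k ∈ box r n,
          (∏ i : Fin r, ∏ j ∈ Ioi i, |(k i : ℝ) ^ 2 - (k j : ℝ) ^ 2|) *
            ∏ i : Fin r, (k i : ℝ) ^ 2 * ((2 * n).choose ((n : ℤ) + k i).toNat : ℝ) ∧
    discreteMacdonaldMehta r n 2 (1 / 2) 2
      = 2 ^ r * ∏ i ∈ Icc 1 r,
          Real.Gamma (1 + (i : ℝ) / 2) ^ 2 / Real.Gamma (1 / 2) *
            (Real.Gamma (2 * (n : ℝ) + 1) * Real.Gamma ((n : ℝ) - i + 3 / 2) /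
              (Real.Gamma ((n : ℝ) - i + 1) * Real.Gamma ((n : ℝ) - (i : ℝ) / 2 + 1) ^ 2)) := by
  refine ⟨fun q h0 h1 => ?_, discreteMacdonaldMehta_eq_limitSum r n, ?_⟩
  · refine (qSum_eq_gammaFactor h0 h1 hrn).trans (congrArg _ (prod_congr rfl fun i hi => ?_))
    exact (gammaFactor_eq (qGamma q) ((mem_Icc.1 hi).2.trans hrn)).symm
  · rw [discreteMacdonaldMehta_eq_limitSum, limitSum_eq hrn]
    refine congrArg _ (prod_congr rfl fun i hi => ?_)
    exact (gammaFactor_eq Real.Gamma ((mem_Icc.1 hi).2.trans hrn)).symm
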